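/- For real $\epsilon,\epsilon'$, $\zeta\in\mathbb{C}$ and $\tau\in\mathbb{C}$ with $\operatorname{Im}\tau>0$, let $$\theta\begin{bmatrix}\epsilon\\ \epsilon'\end{bmatrix}(\zeta,\tau)=\sum_{n\in\mathbb{Z}}\exp\left(2\pi i\left[\tfrac12\left(n+\tfrac{\epsilon}{2}\right)^2\tau+\left(n+\tfrac{\epsilon}{2}\right)\left(\zeta+\tfrac{\epsilon'}{2}\right)\right]\right),$$ and for $|x|<1$ let $(x;x)_\infty=\prod_{n=1}^{\infty}(1-x^n)$. For every $\tau$ in the upper half plane put $q=\exp(2\pi i\tau)$ and $$W=\theta^4\begin{bmatrix}1\\ \frac13\end{bmatrix}(0,\tau)\Big/\theta^4\begin{bmatrix}1\\ \frac23\end{bmatrix}(0,\tau).$$ Then all denominators occurring here and below are nonzero, $$W=\left\{\sqrt3\,\frac{(q^2;q^2)_\infty\,(q^3;q^3)_\infty^2}{(q;q)_\infty^2\,(q^6;q^6)_\infty}\right\}^4,$$ so that $W$ is a function of $q$ on the punctured disc $0<|q|<1$, and this function is holomorphic there and satisfies the Riccati equation $$q\frac{dW}{dq}=\frac{1}{2^3}\left\{\frac{(q;q)_\infty^2\,(q^3;q^3)_\infty^2}{(q^2;q^2)_\infty\,(q^6;q^6)_\infty}\right\}^2\left(W^2-10W+9\right).$$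 -/

import Mathlib

/-- The theta function with real characteristics `[ε; ε']`,
`θ[ε; ε'](ζ, τ) = ∑_{n ∈ ℤ} exp(2πi [ (n + ε/2)² τ / 2 + (n + ε/2)(ζ + ε'/2) ])`. -/
noncomputable def thetaChar (ε ε' : ℝ) (ζ τ : ℂ) : ℂ :=
  ∑' n : ℤ, Complex.exp (2 * Real.pi * Complex.I *
    ((1 / 2 : ℂ) * ((n : ℂ) + (ε : ℂ) / 2) ^ 2 * τ
      + ((n : ℂ) + (ε : ℂ) / 2) * (ζ + (ε' : ℂ) / 2)))

/-- The series of `thetaChar` converges (absolutely) on the upper half plane. -/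
theorem summable_thetaChar (ε ε' : ℝ) (ζ τ : ℂ) (hτ : 0 < τ.im) :
    Summable fun n : ℤ => Complex.exp (2 * Real.pi * Complex.I *
      ((1 / 2 : ℂ) * ((n : ℂ) + (ε : ℂ) / 2) ^ 2 * τ
        + ((n : ℂ) + (ε : ℂ) / 2) * (ζ + (ε' : ℂ) / 2))) := by
  have h := ((summable_jacobiTheta₂_term_iff
    ((ε : ℂ) / 2 * τ + (ζ + (ε' : ℂ) / 2)) τ).2 hτ).mul_left
    (Complex.exp (2 * Real.pi * Complex.I *
      ((1 / 2 : ℂ) * ((ε : ℂ) / 2) ^ 2 * τ + (ε : ℂ) / 2 * (ζ + (ε' : ℂ) / 2))))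
  refine h.congr fun n => ?_
  rw [jacobiTheta₂_term, ← Complex.exp_add]
  congr 1
  ring

/-- The infinite product `(x; x)_∞ = ∏_{n ≥ 1} (1 - x ^ n)`. -/
noncomputable def eulerProduct (x : ℂ) : ℂ :=
  ∏' n : ℕ, (1 - x ^ (n + 1))

/-- The product of `eulerProduct` converges (absolutely) on the open unit disc. -/
theorem multipliable_eulerProduct (x : ℂ) (hx : ‖x‖ < 1) :
    Multipliable fun n : ℕ => 1 - x ^ (n + 1) := by
  have h : Summable fun n : ℕ => ‖-x ^ (n + 1)‖ := by
    simpa [pow_succ] using (summable_geometric_of_lt_one (norm_nonneg x) hx).mul_right ‖x‖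
  simpa [sub_eq_add_neg] using multipliable_one_add_of_summable h

/-- `W(τ) = θ⁴[1; 1/3](0, τ) / θ⁴[1; 2/3](0, τ)`. -/
noncomputable def thetaW (τ : ℂ) : ℂ :=
  thetaChar 1 (1 / 3) 0 τ ^ 4 / thetaChar 1 (2 / 3) 0 τ ^ 4

/-- The nome `q = exp(2πiτ)`. -/
noncomputable def nomeQ (τ : ℂ) : ℂ :=
  Complex.exp (2 * Real.pi * Complex.I * τ)

/-!
Write `x = φ(-q)` and `y = φ(-q³)`, where `φ(-q) = (q; q)² / (q²; q²)` is `phi q`. The Jacobi triple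
product (`triple_product`, the limit of a finite `q`-binomial identity) evaluates the two theta
constants (`thetaChar_one_third`, `thetaChar_two_thirds`) and gives `W = 9 (y / x)⁴`. The factor in
front of the quadratic polynomial in the Riccati equation is `(x y)² / 8`, so after division by `W`
the equation reads `q W' / W = (P² - (10 / 3) P Q + Q²) / 8` with `P = x³ / y` and `Q = 3 y³ / x`.

Both sides are expressed through the cubic theta function `a(q) = 1 + 6 ∑ χ(n) qⁿ / (1 - qⁿ)`, where
`χ` is the nontrivial character modulo `3`.

* `P = 2 a(q²) - a(q)` and `Q = a(q) + 2 a(q²)` (`phi_cube_div`, `three_mul_phi_cube_div`). These are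
  two specialisations of one identity between a theta quotient in a variable `z` and a Lambert
  series (`kron_limit`), at a cube root of unity `z` for the base `q`, and at `z = q` for the base
  `q³`. The identity is the limit of the partial fraction expansion of
  `∏ (1 + x qⁱ) / (1 - x qⁱ)` over finitely many `i`. Hence the right-hand side is
  `(2 / 3) (a(q)² - a(q²)²)`.
* `a(q)² = 1 + 12 (Φ(q) - 3 Φ(q³))` with `Φ(q) = ∑ n qⁿ / (1 - qⁿ)` (`cubicA_sq`). This is Ramanujan's
  elementary computation of the square of a Lambert series (`lamChi_sq`): with
  `uₙ = qⁿ / (1 - qⁿ)` one has `uₘ uₙ = uₘ₊ₙ (1 + uₘ + uₙ)`, and the resulting double sums cancel.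
* The logarithmic derivative of `(q; q)` is `-Φ(q) / q` (`hasDerivAt_eulerProduct`), so the left-hand
  side is `8 ((Φ(q) - 3 Φ(q³)) - (Φ(q²) - 3 Φ(q⁶)))`, which is again `(2 / 3) (a(q)² - a(q²)²)`.
-/

namespace ThetaRiccati

open Finset Filter Topology

/-! ### Finite products -/

/-- The finite product `(q; q)_N = ∏_{n = 1}^N (1 - q ^ n)`. -/
noncomputable def qFac (q : ℂ) (N : ℕ) : ℂ := ∏ i ∈ range N, (1 - q ^ (i + 1))

/-- The finite product `∏_{n = 1}^N (1 + q ^ n) / (1 - q ^ n)`. -/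
noncomputable def qRat (q : ℂ) (N : ℕ) : ℂ := ∏ i ∈ range N, (1 + q ^ (i + 1)) / (1 - q ^ (i + 1))

theorem norm_pow_lt_one {q : ℂ} (hq : ‖q‖ < 1) {k : ℕ} (hk : k ≠ 0) : ‖q ^ k‖ < 1 := by
  rw [norm_pow]; exact pow_lt_one₀ (norm_nonneg _) hq hk

theorem one_sub_ne_zero_of_norm_lt {x : ℂ} (hx : ‖x‖ < 1) : 1 - x ≠ 0 := by
  intro h
  rw [← sub_eq_zero.1 h] at hx
  simp at hx

theorem one_sub_pow_ne_zero {q : ℂ} (hq : ‖q‖ < 1) {k : ℕ} (hk : k ≠ 0) : 1 - q ^ k ≠ 0 :=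
  one_sub_ne_zero_of_norm_lt (norm_pow_lt_one hq hk)

theorem one_add_pow_ne_zero {q : ℂ} (hq : ‖q‖ < 1) {k : ℕ} (hk : k ≠ 0) : 1 + q ^ k ≠ 0 := by
  have := one_sub_ne_zero_of_norm_lt (x := -q ^ k) (by simpa using norm_pow_lt_one hq hk)
  simpa using this

theorem qFac_ne_zero {q : ℂ} (hq : ‖q‖ < 1) (N : ℕ) : qFac q N ≠ 0 :=
  prod_ne_zero_iff.2 fun _ _ => one_sub_pow_ne_zero hq (Nat.succ_ne_zero _)

theorem qFac_succ (q : ℂ) (N : ℕ) : qFac q (N + 1) = qFac q N * (1 - q ^ (N + 1)) :=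
  prod_range_succ _ _

theorem tendsto_qFac {q : ℂ} (hq : ‖q‖ < 1) : Tendsto (qFac q) atTop (𝓝 (eulerProduct q)) :=
  (multipliable_eulerProduct q hq).hasProd.tendsto_prod_nat

theorem eulerProduct_ne_zero {q : ℂ} (hq : ‖q‖ < 1) : eulerProduct q ≠ 0 := by
  have h : Summable fun n : ℕ => ‖-q ^ (n + 1)‖ := by
    simpa [pow_succ] using (summable_geometric_of_lt_one (norm_nonneg q) hq).mul_right ‖q‖
  have := tprod_one_add_ne_zero_of_summable (f := fun n : ℕ => -q ^ (n + 1))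
    (fun n => by
      simpa [sub_eq_add_neg] using one_sub_pow_ne_zero hq (Nat.succ_ne_zero n)) h
  simpa [eulerProduct, sub_eq_add_neg] using this

theorem qRat_eq {q : ℂ} (hq : ‖q‖ < 1) (N : ℕ) : qRat q N = qFac (q ^ 2) N / qFac q N ^ 2 := by
  rw [qRat, qFac, qFac, ← prod_pow, ← prod_div_distrib]
  refine prod_congr rfl fun i _ => ?_
  have := one_sub_pow_ne_zero hq (Nat.succ_ne_zero i)
  field_simp
  ring

theorem tendsto_qRat {q : ℂ} (hq : ‖q‖ < 1) :
    Tendsto (qRat q) atTop (𝓝 (eulerProduct (q ^ 2) / eulerProduct q ^ 2)) := by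
  rw [funext (qRat_eq hq)]
  exact (tendsto_qFac (norm_pow_lt_one hq two_ne_zero)).div ((tendsto_qFac hq).pow 2)
    (pow_ne_zero _ (eulerProduct_ne_zero hq))

/-- A bound that holds along a whole convergent sequence, in the form used for dominated
convergence. -/
theorem exists_norm_le_of_tendsto {u : ℕ → ℂ} {l : ℂ} (h : Tendsto u atTop (𝓝 l)) :
    ∃ C : ℝ, 0 ≤ C ∧ ∀ n, ‖u n‖ ≤ C := by
  obtain ⟨C, hC⟩ := (Metric.isBounded_range_of_tendsto u h).exists_norm_le
  exact ⟨C, (norm_nonneg _).trans (hC (u 0) ⟨0, rfl⟩), fun n => hC _ ⟨n, rfl⟩⟩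

/-- Splitting a product of odd length at its middle factor. -/
theorem prod_range_two_mul_add_one {M : Type*} [CommMonoid M] (f : ℕ → M) (N : ℕ) :
    ∏ i ∈ range (2 * N + 1), f i =
      f N * ∏ n ∈ range N, (f (N + 1 + n) * f (N - 1 - n)) := by
  rw [show 2 * N + 1 = (N + 1) + N by ring, prod_range_add, prod_range_succ, prod_mul_distrib,
    prod_range_reflect]
  ac_rfl

theorem sum_range_two_mul_add_one {M : Type*} [AddCommMonoid M] (f : ℕ → M) (N : ℕ) :
    ∑ i ∈ range (2 * N + 1), f i =
      f N + ∑ n ∈ range N, (f (N + 1 + n) + f (N - 1 - n)) := by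
  rw [show 2 * N + 1 = (N + 1) + N by ring, sum_range_add, sum_range_succ, sum_add_distrib,
    sum_range_reflect]
  ac_rfl

/-! ### A partial fraction expansion -/

/-- Partial fractions of `∏ (1 + x aᵢ) / (1 - x aᵢ)` as a function of `x`. -/
theorem prod_one_add_div_one_sub {ι : Type*} [DecidableEq ι] (s : Finset ι) (a : ι → ℂ)
    (hinj : Set.InjOn a s) (ha : ∀ i ∈ s, a i ≠ 0) (x : ℂ) (hx : ∀ i ∈ s, 1 - x * a i ≠ 0) :
    ∏ i ∈ s, (1 + x * a i) / (1 - x * a i) =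
      1 + ∑ i ∈ s, 2 * (∏ j ∈ s.erase i, (a i + a j) / (a i - a j)) *
        (x * a i / (1 - x * a i)) := by
  -- After clearing denominators both sides are polynomials in `x` of degree at most `#s`
  -- which agree at `0` and at the points `1 / aᵢ`.
  set c : ι → ℂ := fun i => 2 * ∏ j ∈ s.erase i, (a i + a j) / (a i - a j) with hc
  let p : Polynomial ℂ := ∏ i ∈ s, (1 + Polynomial.X * Polynomial.C (a i)) -
    ∏ i ∈ s, (1 - Polynomial.X * Polynomial.C (a i)) -
    ∑ i ∈ s, Polynomial.C (c i * a i) * Polynomial.X *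
      ∏ j ∈ s.erase i, (1 - Polynomial.X * Polynomial.C (a j))
  have hpe : ∀ t : ℂ, p.eval t = ∏ i ∈ s, (1 + t * a i) - ∏ i ∈ s, (1 - t * a i) -
      ∑ i ∈ s, c i * a i * t * ∏ j ∈ s.erase i, (1 - t * a j) := by
    intro t
    simp only [p, Polynomial.eval_sub, Polynomial.eval_add, Polynomial.eval_mul,
      Polynomial.eval_prod, Polynomial.eval_finsetSum, Polynomial.eval_one, Polynomial.eval_X,
      Polynomial.eval_C]
  have hd1 : ∀ i, (1 + Polynomial.X * Polynomial.C (a i)).natDegree ≤ 1 := fun i => by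
    compute_degree
  have hd2 : ∀ i, (1 - Polynomial.X * Polynomial.C (a i)).natDegree ≤ 1 := fun i => by
    compute_degree
  have hdeg : p.natDegree ≤ #s := by
    refine (Polynomial.natDegree_sub_le_of_le (Polynomial.natDegree_sub_le_of_le
      (n := #s) (m := #s) ?_ ?_) (Polynomial.natDegree_sum_le_of_forall_le (n := #s) _ _ ?_)).trans
      (by simp)
    · exact (Polynomial.natDegree_prod_le _ _).trans ((sum_le_sum fun i _ => hd1 i).trans (by simp))
    · exact (Polynomial.natDegree_prod_le _ _).trans ((sum_le_sum fun i _ => hd2 i).trans (by simp))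
    · intro i hi
      have h1 : (∏ j ∈ s.erase i, (1 - Polynomial.X * Polynomial.C (a j))).natDegree ≤ #s - 1 :=
        (Polynomial.natDegree_prod_le _ _).trans
          ((sum_le_sum fun i _ => hd2 i).trans (by simp [card_erase_of_mem hi]))
      have h2 : (Polynomial.C (c i * a i) * Polynomial.X).natDegree ≤ 1 := by compute_degree
      have := card_pos.2 ⟨i, hi⟩
      exact (Polynomial.natDegree_mul_le_of_le h2 h1).trans (by omega)
  have hp : p = 0 := by
    refine Polynomial.eq_zero_of_natDegree_lt_card_of_eval_eq_zero' p
      (insert 0 (s.image fun i => (a i)⁻¹)) ?_ ?_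
    · intro t ht
      rw [hpe]
      rcases mem_insert.1 ht with rfl | ht
      · simp
      obtain ⟨i, hi, rfl⟩ := mem_image.1 ht
      have hai := ha i hi
      have h1 : ∏ j ∈ s, (1 - (a i)⁻¹ * a j) = 0 :=
        prod_eq_zero hi (by rw [inv_mul_cancel₀ hai, sub_self])
      have h2 : ∀ k ∈ s, k ≠ i → c k * a k * (a i)⁻¹ * ∏ j ∈ s.erase k, (1 - (a i)⁻¹ * a j) = 0 :=
        fun k _ hki => by
          rw [prod_eq_zero (mem_erase.2 ⟨hki.symm, hi⟩) (by rw [inv_mul_cancel₀ hai, sub_self]),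
            mul_zero]
      rw [h1, sum_eq_single_of_mem i hi h2, ← mul_prod_erase s _ hi, inv_mul_cancel₀ hai,
        mul_assoc (c i), mul_inv_cancel₀ hai, hc]
      simp only
      rw [mul_one, mul_assoc, ← prod_mul_distrib, sub_zero, sub_eq_zero]
      congr 1
      · norm_num
      refine prod_congr rfl fun j hj => ?_
      have : a i - a j ≠ 0 := sub_ne_zero.2 fun h =>
        (mem_erase.1 hj).1 (hinj (mem_erase.1 hj).2 hi h.symm)
      field_simp
    · rw [card_insert_of_notMem, card_image_of_injOn]
      · omega
      · exact fun i hi j hj h => hinj hi hj (inv_injective h)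
      · simpa using ha
  have h0 := hpe x
  rw [hp, Polynomial.eval_zero] at h0
  have hD : ∏ i ∈ s, (1 - x * a i) ≠ 0 := prod_ne_zero_iff.2 hx
  rw [prod_div_distrib, div_eq_iff hD, add_mul, sum_mul, one_mul]
  have : ∀ i ∈ s, c i * (x * a i / (1 - x * a i)) * ∏ i ∈ s, (1 - x * a i) =
      c i * a i * x * ∏ j ∈ s.erase i, (1 - x * a j) := by
    intro i hi
    have := hx i hi
    rw [← mul_prod_erase s _ hi]
    field_simp
  rw [sum_congr rfl this]
  linear_combination -h0

/-- The geometric case of `prod_one_add_div_one_sub`. -/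
theorem prod_one_add_div_one_sub_pow {q : ℂ} (hq0 : q ≠ 0) (hq : ‖q‖ < 1) (M : ℕ) (x : ℂ)
    (hx : ∀ i ∈ range (M + 1), 1 - x * q ^ i ≠ 0) :
    ∏ i ∈ range (M + 1), (1 + x * q ^ i) / (1 - x * q ^ i) =
      1 + ∑ i ∈ range (M + 1), 2 * ((-1) ^ i * qRat q i * qRat q (M - i)) *
        (x * q ^ i / (1 - x * q ^ i)) := by
  have hinj : ∀ i j : ℕ, i < j → q ^ i - q ^ j ≠ 0 := by
    intro i j hij h
    obtain ⟨k, rfl⟩ := Nat.exists_eq_add_of_lt hij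
    have : q ^ i * (1 - q ^ (k + 1)) = 0 := by rw [← h]; ring
    exact mul_ne_zero (pow_ne_zero _ hq0) (one_sub_pow_ne_zero hq (Nat.succ_ne_zero k)) this
  rw [prod_one_add_div_one_sub (range (M + 1)) (fun i => q ^ i) ?_
    (fun i _ => pow_ne_zero _ hq0) x hx]
  · congr 1
    refine sum_congr rfl fun i hi => ?_
    congr 2
    have hiM : i ≤ M := Nat.lt_succ_iff.1 (mem_range.1 hi)
    obtain ⟨k, rfl⟩ := Nat.exists_eq_add_of_le hiM
    have hs : (range (i + k + 1)).erase i = range i ∪ (Ico (i + 1) (i + k + 1)) := by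
      ext j; simp only [mem_erase, mem_range, mem_union, mem_Ico]; omega
    have hdis : Disjoint (range i) (Ico (i + 1) (i + k + 1)) := by
      rw [Finset.disjoint_left]; intro j; simp only [mem_range, mem_Ico]; omega
    rw [hs, prod_union hdis, prod_Ico_eq_prod_range, Nat.add_sub_cancel_left,
      ← prod_range_reflect, show i + k + 1 - (i + 1) = k by omega]
    congr 1
    · have hsign : ((-1 : ℂ)) ^ i = ∏ _j ∈ range i, (-1 : ℂ) := by simp
      rw [qRat, hsign, ← prod_mul_distrib]
      refine prod_congr rfl fun j hj => ?_
      have hj := mem_range.1 hj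
      obtain ⟨l, rfl⟩ := Nat.exists_eq_add_of_lt hj
      rw [show j + l + 1 - 1 - j = l by omega, ← neg_sub, div_neg]
      have h2 := pow_ne_zero l hq0
      rw [show j + l + 1 = l + (j + 1) by ring, pow_add, ← mul_one_sub, ← mul_add_one,
        mul_div_mul_left _ _ h2, add_comm]
      ring
    · rw [qRat]
      refine prod_congr rfl fun j _ => ?_
      have h2 := pow_ne_zero i hq0
      rw [show i + 1 + j = i + (j + 1) by ring, pow_add, ← mul_one_sub, ← mul_one_add,
        mul_div_mul_left _ _ h2]
  · intro i _ j _ h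
    by_contra hne
    rcases lt_or_gt_of_ne hne with h' | h'
    · exact hinj _ _ h' (sub_eq_zero.2 h)
    · exact hinj _ _ h' (sub_eq_zero.2 h.symm)

/-! ### A Kronecker type identity -/

/-- The summand `z t / (1 - z t) - z⁻¹ t / (1 - z⁻¹ t)` of the Lambert series below. -/
noncomputable def kron (z t : ℂ) : ℂ := z * t / (1 - z * t) - z⁻¹ * t / (1 - z⁻¹ * t)

/-- The factor belonging to the pair of indices `±n`, where `t = q ^ n`. -/
noncomputable def kronFactor (z t : ℂ) : ℂ :=
  (1 + z * t) * (1 + z⁻¹ * t) / ((1 - z * t) * (1 - z⁻¹ * t))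

theorem kron_inv (z t : ℂ) : kron z⁻¹ t = -kron z t := by
  simp only [kron, inv_inv]; ring

theorem kronFactor_inv (z t : ℂ) : kronFactor z⁻¹ t = kronFactor z t := by
  simp only [kronFactor, inv_inv]; ring

/-- The partial fraction expansion of the symmetric finite product; the constant `κ` is the same for
all `z`. -/
theorem kron_finite_aux {q : ℂ} (hq0 : q ≠ 0) (hq : ‖q‖ < 1) (N : ℕ) :
    ∃ κ : ℂ, ∀ z : ℂ, z ≠ 0 → z ≠ 1 → (∀ n : ℕ, 1 - z * q ^ (n + 1) ≠ 0) →
      (∀ n : ℕ, 1 - z⁻¹ * q ^ (n + 1) ≠ 0) →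
      (1 + z) / (1 - z) * ∏ n ∈ range N, kronFactor z (q ^ (n + 1)) =
        κ + 2 * qRat q N ^ 2 * (z / (1 - z)) +
          ∑ n ∈ range N, 2 * ((-1) ^ (n + 1) * qRat q (N + 1 + n) * qRat q (N - 1 - n)) *
            kron z (q ^ (n + 1)) := by
  refine ⟨(-1) ^ N * (1 - ∑ n ∈ range N, 2 * ((-1) ^ (N + 1 + n) * qRat q (N + 1 + n) *
    qRat q (N - 1 - n))), fun z hz hz1 h1 h2 => ?_⟩
  have hz1' : 1 - z ≠ 0 := sub_ne_zero.2 hz1.symm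
  have hqN : q ^ N ≠ 0 := pow_ne_zero _ hq0
  -- the base point that puts the factor `(1 + z) / (1 - z)` into the middle
  set x := z / q ^ N with hx
  have hmid : x * q ^ N = z := by rw [hx]; field_simp
  have hup : ∀ n, x * q ^ (N + 1 + n) = z * q ^ (n + 1) := fun n => by
    rw [hx, show N + 1 + n = N + (n + 1) by ring, pow_add]; field_simp
  have hdown : ∀ n ∈ range N, x * q ^ (N - 1 - n) * q ^ (n + 1) = z := fun n hn => by
    have hn := mem_range.1 hn
    rw [mul_assoc, ← pow_add, show N - 1 - n + (n + 1) = N by omega, hmid]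
  have hdown' : ∀ n ∈ range N, x * q ^ (N - 1 - n) = z / q ^ (n + 1) := fun n hn => by
    rw [eq_div_iff (pow_ne_zero _ hq0), hdown n hn]
  have hne : ∀ n, z / q ^ (n + 1) - 1 ≠ 0 := fun n h => h2 n <| by
    have := pow_ne_zero (n + 1) hq0
    rw [sub_eq_zero, div_eq_iff this, one_mul] at h
    rw [← h]; field_simp; simp
  have key := prod_one_add_div_one_sub_pow hq0 hq (2 * N) x ?_
  · rw [prod_range_two_mul_add_one, sum_range_two_mul_add_one, hmid] at key
    have hP : ∀ n ∈ range N, (1 + x * q ^ (N + 1 + n)) / (1 - x * q ^ (N + 1 + n)) *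
        ((1 + x * q ^ (N - 1 - n)) / (1 - x * q ^ (N - 1 - n))) =
        (-1) * kronFactor z (q ^ (n + 1)) := by
      intro n hn
      rw [hup, hdown' n hn, kronFactor]
      have a1 := h1 n
      have a2 := h2 n
      have a3 := hne n
      have a4 := pow_ne_zero (n + 1) hq0
      have a5 : 1 - z / q ^ (n + 1) ≠ 0 := by rw [← neg_sub]; exact neg_ne_zero.2 a3
      have e1 : 1 - z / q ^ (n + 1) = -(z / q ^ (n + 1)) * (1 - z⁻¹ * q ^ (n + 1)) := by
        field_simp; ring
      have e2 : 1 + z / q ^ (n + 1) = (z / q ^ (n + 1)) * (1 + z⁻¹ * q ^ (n + 1)) := by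
        field_simp; ring
      rw [e1, e2]
      have a6 : z / q ^ (n + 1) ≠ 0 := div_ne_zero hz a4
      generalize z / q ^ (n + 1) = y at a6
      generalize z⁻¹ * q ^ (n + 1) = w at a2 ⊢
      field_simp
    have hS : ∀ n ∈ range N,
        2 * ((-1) ^ (N + 1 + n) * qRat q (N + 1 + n) * qRat q (2 * N - (N + 1 + n))) *
            (x * q ^ (N + 1 + n) / (1 - x * q ^ (N + 1 + n))) +
          2 * ((-1) ^ (N - 1 - n) * qRat q (N - 1 - n) * qRat q (2 * N - (N - 1 - n))) *
            (x * q ^ (N - 1 - n) / (1 - x * q ^ (N - 1 - n))) =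
        (-1) ^ N * (2 * ((-1) ^ (n + 1) * qRat q (N + 1 + n) * qRat q (N - 1 - n)) *
            kron z (q ^ (n + 1))) -
          2 * ((-1) ^ (N + 1 + n) * qRat q (N + 1 + n) * qRat q (N - 1 - n)) := by
      intro n hn
      rw [hup, hdown' n hn]
      have hn := mem_range.1 hn
      rw [show 2 * N - (N + 1 + n) = N - 1 - n by omega,
        show 2 * N - (N - 1 - n) = N + 1 + n by omega]
      have s1 : (-1 : ℂ) ^ (N + 1 + n) = (-1) ^ N * (-1) ^ (n + 1) := by
        rw [← pow_add]; congr 1; ring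
      have s2 : (-1 : ℂ) ^ (N - 1 - n) = (-1) ^ N * (-1) ^ (n + 1) := by
        have hNn : N = (N - 1 - n) + (n + 1) := by omega
        have : (-1 : ℂ) ^ N = (-1) ^ (N - 1 - n) * (-1) ^ (n + 1) := by
          rw [← pow_add, ← hNn]
        rw [this, mul_assoc, ← mul_pow]; norm_num
      have e1 : z / q ^ (n + 1) / (1 - z / q ^ (n + 1)) =
          -1 - z⁻¹ * q ^ (n + 1) / (1 - z⁻¹ * q ^ (n + 1)) := by
        have a2 := h2 n
        have a3 := hne n
        have a4 := pow_ne_zero (n + 1) hq0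
        have a5 : 1 - z / q ^ (n + 1) ≠ 0 := by rw [← neg_sub]; exact neg_ne_zero.2 a3
        have e3 : z / q ^ (n + 1) * (z⁻¹ * q ^ (n + 1)) = 1 := by field_simp
        generalize z / q ^ (n + 1) = y at a5 e3 ⊢
        generalize z⁻¹ * q ^ (n + 1) = w at a2 e3 ⊢
        rw [div_eq_iff a5]
        field_simp
        linear_combination -e3
      rw [s1, s2, e1, kron]
      ring
    rw [prod_congr rfl hP, sum_congr rfl hS, prod_mul_distrib, prod_const, card_range,
      sum_sub_distrib, ← mul_sum, show 2 * N - N = N by omega] at key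
    have hsq : ((-1 : ℂ) ^ N) * (-1) ^ N = 1 := by rw [← mul_pow]; norm_num
    set A := ∏ n ∈ range N, kronFactor z (q ^ (n + 1))
    set B := ∑ n ∈ range N, 2 * ((-1) ^ (n + 1) * qRat q (N + 1 + n) * qRat q (N - 1 - n)) *
            kron z (q ^ (n + 1))
    set C := ∑ n ∈ range N, 2 * ((-1) ^ (N + 1 + n) * qRat q (N + 1 + n) * qRat q (N - 1 - n))
    linear_combination (-1) ^ N * key + (2 * qRat q N ^ 2 * (z / (1 - z)) + B -
      (1 + z) / (1 - z) * A) * hsq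
  · intro i hi
    have hi := mem_range.1 hi
    rcases lt_trichotomy i N with h | rfl | h
    · obtain ⟨n, rfl⟩ : ∃ n, i = N - 1 - n := ⟨N - 1 - i, by omega⟩
      by_cases hn : n < N
      · rw [hdown' n (mem_range.2 hn), ← neg_sub]; exact neg_ne_zero.2 (hne n)
      · obtain ⟨m, rfl⟩ : ∃ m, N = m + 1 := ⟨N - 1, by omega⟩
        rw [show m + 1 - 1 - n = m + 1 - 1 - m by omega, hdown' m (by simp), ← neg_sub]
        exact neg_ne_zero.2 (hne m)
    · rwa [hmid]
    · obtain ⟨n, rfl⟩ := Nat.exists_eq_add_of_lt h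
      rw [show N + n + 1 = N + 1 + n by ring, hup]; exact h1 n

/-- The finite form of the identity between theta quotients and Lambert series. The additive constant of the partial fraction expansion is
found by comparing the values at `z` and `z⁻¹`. -/
theorem kron_finite {q : ℂ} (hq0 : q ≠ 0) (hq : ‖q‖ < 1) (N : ℕ) {z : ℂ} (hz : z ≠ 0)
    (hz1 : z ≠ 1) (h1 : ∀ n : ℕ, 1 - z * q ^ (n + 1) ≠ 0)
    (h2 : ∀ n : ℕ, 1 - z⁻¹ * q ^ (n + 1) ≠ 0) :
    (1 + z) / (1 - z) * ∏ n ∈ range N, kronFactor z (q ^ (n + 1)) =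
      qRat q N ^ 2 * ((1 + z) / (1 - z)) +
        ∑ n ∈ range N, 2 * ((-1) ^ (n + 1) * qRat q (N + 1 + n) * qRat q (N - 1 - n)) *
          kron z (q ^ (n + 1)) := by
  obtain ⟨κ, hκ⟩ := kron_finite_aux hq0 hq N
  have e1 := hκ z hz hz1 h1 h2
  have e2 := hκ z⁻¹ (inv_ne_zero hz) (inv_ne_one.2 hz1) h2 (by simpa using h1)
  simp only [kron_inv, kronFactor_inv, mul_neg, sum_neg_distrib] at e2
  have hz1' : 1 - z ≠ 0 := sub_ne_zero.2 hz1.symm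
  have hz1'' : 1 - z⁻¹ ≠ 0 := sub_ne_zero.2 (inv_ne_one.2 hz1).symm
  have f1 : (1 + z⁻¹) / (1 - z⁻¹) = -((1 + z) / (1 - z)) := by
    have : z - 1 ≠ 0 := sub_ne_zero.2 hz1
    field_simp; ring
  have f2 : z⁻¹ / (1 - z⁻¹) = -1 - z / (1 - z) := by
    have : z - 1 ≠ 0 := sub_ne_zero.2 hz1
    field_simp; ring
  have f3 : (1 + z) / (1 - z) = 1 + 2 * (z / (1 - z)) := by field_simp; ring
  rw [f1, f2] at e2
  linear_combination (e1 - e2) / 2 - qRat q N ^ 2 * f3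

theorem summable_norm_kron {q : ℂ} (hq : ‖q‖ < 1) (z : ℂ) :
    Summable fun n : ℕ => ‖kron z (q ^ (n + 1))‖ := by
  have key : ∀ w : ℂ, Summable fun n : ℕ => ‖w * q ^ (n + 1) / (1 - w * q ^ (n + 1))‖ := by
    intro w
    have hs : Summable fun n : ℕ => ‖w * q ^ (n + 1)‖ := by
      simpa [pow_succ] using
        ((summable_geometric_of_lt_one (norm_nonneg q) hq).mul_right ‖q‖).mul_left ‖w‖
    have h0 : Tendsto (fun n : ℕ => 1 - w * q ^ (n + 1)) atTop (𝓝 1) := by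
      simpa using (tendsto_const_nhds (x := (1 : ℂ))).sub hs.of_norm.tendsto_atTop_zero
    have h1 : ∀ᶠ n : ℕ in atTop, 1 / 2 < ‖1 - w * q ^ (n + 1)‖ := by
      refine h0.norm.eventually (lt_mem_nhds ?_); norm_num
    refine summable_of_isBigO_nat hs (Asymptotics.IsBigO.of_bound 2 ?_)
    filter_upwards [h1] with n hn
    rw [norm_norm, norm_norm, norm_div, div_le_iff₀ (by linarith)]
    nlinarith [norm_nonneg (w * q ^ (n + 1))]
  exact .of_nonneg_of_le (fun _ => norm_nonneg _) (fun _ => norm_sub_le _ _)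
    ((key z).add (key z⁻¹))

/-- The limit of `kron_finite`: if the partial products converge to `S`, then `S` is given by a
Lambert series. -/
theorem kron_limit {q : ℂ} (hq0 : q ≠ 0) (hq : ‖q‖ < 1) {z : ℂ} (hz : z ≠ 0)
    (hz1 : z ≠ 1) (h1 : ∀ n : ℕ, 1 - z * q ^ (n + 1) ≠ 0)
    (h2 : ∀ n : ℕ, 1 - z⁻¹ * q ^ (n + 1) ≠ 0) {S : ℂ}
    (hS : Tendsto (fun N => (1 + z) / (1 - z) * ∏ n ∈ range N, kronFactor z (q ^ (n + 1)))
      atTop (𝓝 S)) :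
    S = (eulerProduct (q ^ 2) / eulerProduct q ^ 2) ^ 2 *
      ((1 + z) / (1 - z) + 2 * ∑' n : ℕ, (-1) ^ (n + 1) * kron z (q ^ (n + 1))) := by
  have hT := tendsto_qRat hq
  set T := eulerProduct (q ^ 2) / eulerProduct q ^ 2
  obtain ⟨C, hC0, hC⟩ := exists_norm_le_of_tendsto hT
  have hsum : Tendsto (fun N => ∑' n : ℕ, if n ∈ range N then
      2 * ((-1) ^ (n + 1) * qRat q (N + 1 + n) * qRat q (N - 1 - n)) * kron z (q ^ (n + 1)) else 0)
      atTop (𝓝 (∑' n : ℕ, 2 * ((-1) ^ (n + 1) * T * T) * kron z (q ^ (n + 1)))) := by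
    refine tendsto_tsum_of_dominated_convergence
      (bound := fun n => 2 * (C * C) * ‖kron z (q ^ (n + 1))‖)
      ((summable_norm_kron hq z).mul_left _) ?_ ?_
    · intro n
      have t1 : Tendsto (fun N => qRat q (N + 1 + n)) atTop (𝓝 T) :=
        hT.comp (tendsto_atTop_mono (fun N => by show N ≤ N + 1 + n; omega) tendsto_id)
      have t2 : Tendsto (fun N => qRat q (N - 1 - n)) atTop (𝓝 T) := by
        refine hT.comp ?_
        simp_rw [Nat.sub_sub]
        exact tendsto_sub_atTop_nat _
      refine Tendsto.congr' ?_ (((t1.const_mul _).mul t2).const_mul 2 |>.mul_const _)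
      filter_upwards [eventually_gt_atTop n] with N hN
      rw [if_pos (mem_range.2 hN)]
    · refine .of_forall fun N n => ?_
      split_ifs
      · rw [norm_mul, norm_mul, norm_mul, norm_mul, norm_pow, norm_neg, norm_one, one_pow, one_mul,
          Complex.norm_ofNat]
        gcongr
        · exact hC _
        · exact hC _
      · rw [norm_zero]; positivity
  have hlim := ((hT.pow 2).mul_const ((1 + z) / (1 - z))).add hsum
  have hval : T ^ 2 * ((1 + z) / (1 - z) +
      2 * ∑' n : ℕ, (-1) ^ (n + 1) * kron z (q ^ (n + 1))) = T ^ 2 * ((1 + z) / (1 - z)) +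
        ∑' n : ℕ, 2 * ((-1) ^ (n + 1) * T * T) * kron z (q ^ (n + 1)) := by
    rw [mul_add, ← tsum_mul_left, ← tsum_mul_left]
    congr 1
    refine tsum_congr fun n => ?_
    ring
  rw [hval]
  refine tendsto_nhds_unique hS (hlim.congr fun N => ?_)
  rw [kron_finite hq0 hq N hz hz1 h1 h2]
  congr 1
  rw [tsum_eq_sum (s := range N) fun n hn => if_neg hn]
  exact sum_congr rfl fun n hn => if_pos hn

/-! ### Lambert series and the square of the cubic theta function -/

/-- The Lambert coefficient `q ^ n / (1 - q ^ n)`; it is `0` at `n = 0` because `1 / 0 = 0`. -/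
noncomputable def lam (q : ℂ) (n : ℕ) : ℂ := q ^ n / (1 - q ^ n)

/-- The nontrivial Dirichlet character modulo `3`, with complex values. -/
def chi (n : ℕ) : ℂ := if n % 3 = 1 then 1 else if n % 3 = 2 then -1 else 0

/-- The numbers `2 cos (2πn/3)`. -/
def cos3 (n : ℕ) : ℂ := if n % 3 = 0 then 2 else -1

/-- The Lambert series `∑ χ(n) q ^ n / (1 - q ^ n)`. -/
noncomputable def lamChi (q : ℂ) : ℂ := ∑' n : ℕ, chi n * lam q n

/-- The Lambert series `∑ n q ^ n / (1 - q ^ n)`. -/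
noncomputable def lamId (q : ℂ) : ℂ := ∑' n : ℕ, (n : ℂ) * lam q n

@[simp] theorem lam_zero (q : ℂ) : lam q 0 = 0 := by simp [lam]

theorem norm_chi_le (n : ℕ) : ‖chi n‖ ≤ 1 := by
  unfold chi; split_ifs <;> simp

theorem norm_cos3_le (n : ℕ) : ‖cos3 n‖ ≤ 2 := by
  unfold cos3; split_ifs <;> simp

@[simp] theorem chi_zero : chi 0 = 0 := by simp [chi]

/-- The product formula for sines, `4 sin α sin β = 2 cos (α - β) - 2 cos (α + β)`, at the angles
`2πm/3` and `2π(m + k)/3`. -/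
theorem cos3_sub_cos3 (m k : ℕ) : cos3 k - cos3 (m + (m + k)) = 3 * (chi m * chi (m + k)) := by
  have hm : m % 3 < 3 := Nat.mod_lt _ (by norm_num)
  have hk : k % 3 < 3 := Nat.mod_lt _ (by norm_num)
  unfold cos3 chi
  rw [Nat.add_mod m (m + k), Nat.add_mod m k]
  interval_cases m % 3 <;> interval_cases k % 3 <;> norm_num

/-- The closed form of the partial sums of `cos (2πk/3)`, which turns the linear term `lamChi` into
the partial sums that also occur in its square. -/
theorem chi_eq_cos3 (n : ℕ) : chi n = cos3 n + 2 * ∑ k ∈ range n, cos3 k - 2 := by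
  have key : ∀ m, chi (m + 1) - cos3 (m + 1) - (chi m - cos3 m) = 2 * cos3 m := by
    intro m
    have hm : m % 3 < 3 := Nat.mod_lt _ (by norm_num)
    unfold cos3 chi
    rw [Nat.add_mod m 1]
    interval_cases m % 3 <;> norm_num
  induction n with
  | zero => simp [cos3]
  | succ m ih => rw [sum_range_succ]; linear_combination key m + ih

theorem norm_lam_le {q : ℂ} (hq : ‖q‖ < 1) (n : ℕ) : ‖lam q n‖ ≤ (1 - ‖q‖)⁻¹ * ‖q‖ ^ n := by
  have h1 : 0 < 1 - ‖q‖ := by linarith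
  rcases Nat.eq_zero_or_pos n with rfl | hn
  · rw [lam_zero, norm_zero]; positivity
  rw [lam, norm_div, norm_pow, div_eq_inv_mul]
  gcongr
  calc 1 - ‖q‖ ≤ 1 - ‖q ^ n‖ := by
        rw [norm_pow]; gcongr; exact pow_le_of_le_one (norm_nonneg _) hq.le hn.ne'
    _ ≤ ‖1 - q ^ n‖ := by simpa using norm_sub_norm_le 1 (q ^ n)

theorem summable_nat_mul_lam {q : ℂ} (hq : ‖q‖ < 1) : Summable fun n : ℕ => (n : ℝ) * ‖lam q n‖ := by
  have h := (summable_pow_mul_geometric_of_norm_lt_one 1 (r := ‖q‖) (by simpa using hq)).mul_left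
    (1 - ‖q‖)⁻¹
  refine .of_nonneg_of_le (fun n => by positivity) (fun n => ?_) h
  calc (n : ℝ) * ‖lam q n‖ ≤ n * ((1 - ‖q‖)⁻¹ * ‖q‖ ^ n) := by gcongr; exact norm_lam_le hq n
    _ = _ := by ring

theorem summable_norm_lam {q : ℂ} (hq : ‖q‖ < 1) : Summable fun n : ℕ => ‖lam q n‖ := by
  refine .of_nonneg_of_le (fun n => norm_nonneg _) (fun n => ?_) (summable_nat_mul_lam hq)
  rcases Nat.eq_zero_or_pos n with rfl | hn
  · simp
  · exact le_mul_of_one_le_left (norm_nonneg _) (by exact_mod_cast hn)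

/-- A coefficient sequence of at most linear growth may be put in front of `lam q`. -/
theorem summable_mul_lam {q : ℂ} (hq : ‖q‖ < 1) {f : ℕ → ℂ} {C : ℝ}
    (hf : ∀ n, ‖f n‖ ≤ C * n + C) : Summable fun n : ℕ => ‖f n * lam q n‖ := by
  refine .of_nonneg_of_le (fun n => norm_nonneg _) (fun n => ?_)
    (((summable_nat_mul_lam hq).mul_left C).add ((summable_norm_lam hq).mul_left C))
  rw [norm_mul]
  calc ‖f n‖ * ‖lam q n‖ ≤ (C * n + C) * ‖lam q n‖ := by gcongr; exact hf n
    _ = _ := by ring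

/-- The addition law behind Ramanujan's computation. -/
theorem lam_mul_lam {q : ℂ} (hq : ‖q‖ < 1) {m n : ℕ} (hm : m ≠ 0) (hn : n ≠ 0) :
    lam q m * lam q n = lam q (m + n) * (1 + lam q m + lam q n) := by
  have h1 := one_sub_pow_ne_zero hq hm
  have h2 := one_sub_pow_ne_zero hq hn
  have h3 := one_sub_pow_ne_zero hq (k := m + n) (by omega)
  unfold lam
  rw [pow_add] at *
  field_simp
  ring

/-- Summing over `ℕ × ℕ` by the larger index. -/
theorem hasSum_triangle {F : ℕ × ℕ → ℂ} (hF : Summable F) :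
    HasSum (fun n : ℕ => F (n, n) + ∑ m ∈ range n, (F (m, n) + F (n, m))) (∑' p, F p) := by
  have hA := hF.indicator {p : ℕ × ℕ | p.2 ≤ p.1}
  have hB := hF.indicator {p : ℕ × ℕ | p.2 ≤ p.1}ᶜ
  have hAB : ∑' p, F p = ∑' p, Set.indicator {p : ℕ × ℕ | p.2 ≤ p.1} F p +
      ∑' p, Set.indicator {p : ℕ × ℕ | p.2 ≤ p.1}ᶜ F p := by
    rw [← hA.tsum_add hB]
    exact tsum_congr fun p => (congrFun (Set.indicator_self_add_compl _ F) p).symm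
  have eA : ∀ n, ∑' m, Set.indicator {p : ℕ × ℕ | p.2 ≤ p.1} F (n, m) =
      ∑ m ∈ range (n + 1), F (n, m) := by
    intro n
    rw [tsum_eq_sum (s := range (n + 1))]
    · refine sum_congr rfl fun m hm => Set.indicator_of_mem ?_ _
      have := mem_range.1 hm
      show m ≤ n
      omega
    · intro m hm
      refine Set.indicator_of_notMem (fun h => hm (mem_range.2 ?_)) _
      have : m ≤ n := h
      omega
  have eB : ∀ n, ∑' m, Set.indicator {p : ℕ × ℕ | p.2 ≤ p.1}ᶜ F (m, n) =
      ∑ m ∈ range n, F (m, n) := by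
    intro n
    rw [tsum_eq_sum (s := range n)]
    · refine sum_congr rfl fun m hm => Set.indicator_of_mem ?_ _
      have := mem_range.1 hm
      show ¬ n ≤ m
      omega
    · intro m hm
      refine Set.indicator_of_notMem (fun h => hm (mem_range.2 ?_)) _
      have : ¬ n ≤ m := h
      omega
  have hB' := (Equiv.prodComm ℕ ℕ).summable_iff.2 hB
  have sA := hA.prod
  have sB := hB'.prod
  simp only [Function.comp_apply, Equiv.prodComm_apply, Prod.swap_prod_mk] at sB
  have tA := hA.tsum_prod
  have tB := hB'.tsum_prod
  have tC := (Equiv.prodComm ℕ ℕ).tsum_eq (Set.indicator {p : ℕ × ℕ | p.2 ≤ p.1}ᶜ F)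
  simp only [Function.comp_apply, Equiv.prodComm_apply, Prod.swap_prod_mk] at tB
  simp only [Equiv.prodComm_apply] at tC
  rw [tC] at tB
  simp only [eA, eB] at sA sB tA tB
  have e : ∀ n, F (n, n) + ∑ m ∈ range n, (F (m, n) + F (n, m)) =
      ∑ m ∈ range (n + 1), F (n, m) + ∑ m ∈ range n, F (m, n) := by
    intro n; rw [sum_range_succ, sum_add_distrib]; ring
  simp only [e]
  rw [hAB, tA, tB]
  exact sA.hasSum.add sB.hasSum

/-- Summing over `ℕ × ℕ` along antidiagonals. -/
theorem hasSum_antidiagonal {F : ℕ × ℕ → ℂ} (hF : Summable F) :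
    HasSum (fun n : ℕ => ∑ p ∈ antidiagonal n, F p) (∑' p, F p) := by
  have h := (HasAntidiagonal.sigmaAntidiagonalEquivProd (A := ℕ)).hasSum_iff.2 hF.hasSum
  refine (h.sigma fun n => hasSum_fintype _).congr_fun fun n => ?_
  exact (sum_coe_sort (antidiagonal n) F).symm

/-- The terms of `(∑ uₙ)²` along an antidiagonal, where `lam_mul_lam` makes `u` at the larger index a
common factor. -/
theorem sum_antidiagonal_lam {q : ℂ} (hq : ‖q‖ < 1) (n : ℕ) :
    ∑ p ∈ antidiagonal n, lam q p.1 * lam q p.2 =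
      n * lam q n - lam q n + 2 * (lam q n * ∑ k ∈ range n, lam q k) := by
  rcases n with - | m
  · simp
  rw [Nat.sum_antidiagonal_eq_sum_range_succ (fun i j => lam q i * lam q j), Nat.succ_eq_add_one,
    sum_range_succ, sum_range_succ', sum_range_succ']
  simp only [lam_zero, Nat.sub_self, mul_zero, zero_mul, add_zero]
  have hr : ∑ k ∈ range m, lam q (m - k) = ∑ k ∈ range m, lam q (k + 1) := by
    rw [← sum_range_reflect]
    refine sum_congr rfl fun k hk => ?_
    have := mem_range.1 hk
    congr 1
    omega
  have ht : ∀ k ∈ range m, lam q (k + 1) * lam q (m + 1 - (k + 1)) =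
      lam q (m + 1) + lam q (m + 1) * lam q (k + 1) + lam q (m + 1) * lam q (m - k) := by
    intro k hk
    have := mem_range.1 hk
    rw [show m + 1 - (k + 1) = m - k by omega, lam_mul_lam hq (by omega) (by omega),
      show k + 1 + (m - k) = m + 1 by omega]
    ring
  rw [sum_congr rfl ht, sum_add_distrib, sum_add_distrib, ← mul_sum, ← mul_sum, hr, sum_const,
    card_range, nsmul_eq_mul]
  push_cast
  ring

/-- The terms of a double sum with coefficients `cos3 (n - m)` in terms of the difference
`k = n - m`, using `uₙ₋ₖ uₙ = uₖ uₙ₋ₖ - uₙ uₖ - uₙ`. -/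
theorem sum_range_cos3_lam {q : ℂ} (hq : ‖q‖ < 1) (n : ℕ) :
    ∑ m ∈ range n, cos3 (n - m) * (lam q m * lam q n) =
      ∑ p ∈ antidiagonal n, cos3 p.1 * lam q p.1 * lam q p.2 -
        lam q n * ∑ k ∈ range n, cos3 k * lam q k - lam q n * ∑ k ∈ range n, cos3 k +
        2 * lam q n := by
  rcases n with - | m
  · simp
  rw [Nat.sum_antidiagonal_eq_sum_range_succ (fun i j => cos3 i * lam q i * lam q j),
    Nat.succ_eq_add_one, sum_range_succ _ (m + 1), sum_range_succ', sum_range_succ',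
    sum_range_succ' (fun k => cos3 k * lam q k), sum_range_succ' cos3]
  simp only [lam_zero, Nat.sub_self, mul_zero, zero_mul, add_zero]
  have hr : ∑ k ∈ range m, cos3 (m + 1 - (k + 1)) * (lam q (k + 1) * lam q (m + 1)) =
      ∑ k ∈ range m, cos3 (k + 1) * (lam q (m - k) * lam q (m + 1)) := by
    rw [← sum_range_reflect]
    refine sum_congr rfl fun k hk => ?_
    have := mem_range.1 hk
    rw [show m + 1 - (m - 1 - k + 1) = k + 1 by omega, show m - 1 - k + 1 = m - k by omega]
  have ht : ∀ k ∈ range m, cos3 (k + 1) * (lam q (m - k) * lam q (m + 1)) =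
      cos3 (k + 1) * lam q (k + 1) * lam q (m + 1 - (k + 1)) -
        lam q (m + 1) * (cos3 (k + 1) * lam q (k + 1)) - lam q (m + 1) * cos3 (k + 1) := by
    intro k hk
    have := mem_range.1 hk
    have h := lam_mul_lam hq (m := k + 1) (n := m - k) (by omega) (by omega)
    rw [show k + 1 + (m - k) = m + 1 by omega] at h
    rw [show m + 1 - (k + 1) = m - k by omega]
    linear_combination -cos3 (k + 1) * h
  rw [hr, sum_congr rfl ht, sum_sub_distrib, sum_sub_distrib, ← mul_sum, ← mul_sum,
    show cos3 0 = 2 from rfl]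
  ring

/-- Ramanujan's computation of the square of the Lambert series of `χ`. The product
`3 χ(m) χ(n)` splits into `cos3 (n - m)` and `cos3 (m + n)`; the first part is summed by the larger
index and the second one along antidiagonals, and all remaining partial sums cancel. -/
theorem lamChi_sq {q : ℂ} (hq : ‖q‖ < 1) :
    lamChi q + 3 * lamChi q ^ 2 = ∑' n : ℕ,
      (2 * (lam q n + lam q n ^ 2) * (1 + cos3 n) - n * lam q n * cos3 n) := by
  set u := lam q
  set c := cos3
  have hun : Summable fun n => ‖u n‖ := summable_norm_lam hq
  have hcun : Summable fun n => ‖c n * u n‖ :=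
    summable_mul_lam hq (C := 2) fun n => (norm_cos3_le n).trans (by
      have : (0 : ℝ) ≤ n := by positivity
      linarith)
  have hxn : Summable fun n => ‖chi n * u n‖ :=
    summable_mul_lam hq (C := 1) fun n => (norm_chi_le n).trans (by
      have : (0 : ℝ) ≤ n := by positivity
      linarith)
  have hxu := summable_mul_of_summable_norm hxn hxn
  have hcu := summable_mul_of_summable_norm hcun hun
  have huu := summable_mul_of_summable_norm hun hun
  have hF1 : Summable fun p : ℕ × ℕ => c (p.1 + p.2) * (u p.1 * u p.2) := by
    refine .of_norm_bounded (huu.norm.mul_left 2) fun p => ?_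
    rw [norm_mul]
    gcongr
    exact norm_cos3_le _
  have hF2 := hF1.add (hxu.mul_left 3)
  have hsq : 3 * lamChi q ^ 2 = (∑' p : ℕ × ℕ, (c (p.1 + p.2) * (u p.1 * u p.2) +
      3 * (chi p.1 * u p.1 * (chi p.2 * u p.2)))) -
      ∑' p : ℕ × ℕ, c (p.1 + p.2) * (u p.1 * u p.2) := by
    rw [hF1.tsum_add (hxu.mul_left 3), tsum_mul_left, add_sub_cancel_left, sq, lamChi,
      tsum_mul_tsum_of_summable_norm hxn hxn]
  -- the terms with `c (m + n)`, by antidiagonals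
  have h1 : HasSum (fun n : ℕ => (n : ℂ) * c n * u n - c n * u n +
      2 * (c n * u n * ∑ k ∈ range n, u k)) (∑' p : ℕ × ℕ, c (p.1 + p.2) * (u p.1 * u p.2)) := by
    refine (hasSum_antidiagonal hF1).congr_fun fun n => ?_
    have : ∀ p ∈ antidiagonal n, c (p.1 + p.2) * (u p.1 * u p.2) = c n * (u p.1 * u p.2) :=
      fun p hp => by rw [mem_antidiagonal.1 hp]
    rw [sum_congr rfl this, ← mul_sum, sum_antidiagonal_lam hq]
    ring
  -- the terms with `c |m - n|`, by the larger index
  have h2 : HasSum (fun n : ℕ => 2 * u n ^ 2 + 2 * (∑ p ∈ antidiagonal n, c p.1 * u p.1 * u p.2 -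
      u n * ∑ k ∈ range n, c k * u k - u n * ∑ k ∈ range n, c k + 2 * u n))
      (∑' p : ℕ × ℕ, (c (p.1 + p.2) * (u p.1 * u p.2) +
      3 * (chi p.1 * u p.1 * (chi p.2 * u p.2)))) := by
    refine (hasSum_triangle hF2).congr_fun fun n => ?_
    have e : ∀ m ∈ range n, c (m + n) * (u m * u n) + 3 * (chi m * u m * (chi n * u n)) +
        (c (n + m) * (u n * u m) + 3 * (chi n * u n * (chi m * u m))) =
        2 * (c (n - m) * (u m * u n)) := by
      intro m hm
      obtain ⟨k, rfl⟩ := Nat.exists_eq_add_of_lt (mem_range.1 hm)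
      have h := cos3_sub_cos3 m (k + 1)
      rw [show m + k + 1 - m = k + 1 by omega, add_comm (m + k + 1) m, add_assoc m k 1]
      linear_combination (-2 * u m * u (m + (k + 1))) * h
    have e0 := cos3_sub_cos3 n 0
    rw [add_zero, show cos3 0 = 2 from rfl] at e0
    simp only
    rw [sum_congr rfl e, ← mul_sum, sum_range_cos3_lam hq]
    linear_combination u n ^ 2 * e0
  have h3 : HasSum (fun n => c n * u n + 2 * (u n * ∑ k ∈ range n, c k) - 2 * u n)
      (lamChi q) := by
    refine hxn.of_norm.hasSum.congr_fun fun n => ?_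
    rw [chi_eq_cos3]
    ring
  -- the product `(∑ c u) (∑ u)` in two arrangements
  have h4 : HasSum (fun n => ∑ p ∈ antidiagonal n, c p.1 * u p.1 * u p.2 -
      (c n * u n ^ 2 + u n * ∑ k ∈ range n, c k * u k + c n * u n * ∑ k ∈ range n, u k)) 0 := by
    have a := (summable_norm_sum_mul_antidiagonal_of_summable_norm hcun hun).of_norm.hasSum
    rw [← tsum_mul_tsum_eq_tsum_sum_antidiagonal_of_summable_norm hcun hun,
      tsum_mul_tsum_of_summable_norm hcun hun] at a
    have b := a.sub (hasSum_triangle hcu)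
    rw [sub_self] at b
    refine b.congr_fun fun n => ?_
    have e : ∀ m ∈ range n, c m * u m * u n + c n * u n * u m =
        u n * (c m * u m) + c n * u n * u m := fun m _ => by ring
    simp only
    rw [sum_congr rfl e, sum_add_distrib, ← mul_sum, ← mul_sum]
    ring
  have h := ((h3.add (h2.sub h1)).sub (h4.mul_left 2)).tsum_eq
  rw [mul_zero, sub_zero, ← hsq] at h
  rw [← h]
  refine tsum_congr fun n => ?_
  ring

/-- The theta quotient `φ(-q) = (q; q)² / (q²; q²)`. -/
noncomputable def phi (q : ℂ) : ℂ := eulerProduct q ^ 2 / eulerProduct (q ^ 2)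

/-- The cubic theta function `a(q) = 1 + 6 ∑ χ(n) q ^ n / (1 - q ^ n)`. -/
noncomputable def cubicA (q : ℂ) : ℂ := 1 + 6 * lamChi q

theorem phi_ne_zero {q : ℂ} (hq : ‖q‖ < 1) : phi q ≠ 0 :=
  div_ne_zero (pow_ne_zero _ (eulerProduct_ne_zero hq))
    (eulerProduct_ne_zero (norm_pow_lt_one hq two_ne_zero))

theorem tendsto_qRat_phi {q : ℂ} (hq : ‖q‖ < 1) : Tendsto (qRat q) atTop (𝓝 (phi q)⁻¹) := by
  simpa [phi] using tendsto_qRat hq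

theorem summable_chi_lam {q : ℂ} (hq : ‖q‖ < 1) : Summable fun n => ‖chi n * lam q n‖ :=
  summable_mul_lam hq (C := 1) fun n => (norm_chi_le n).trans (by
    have : (0 : ℝ) ≤ n := by positivity
    linarith)

theorem lam_pow (q : ℂ) (k n : ℕ) : lam (q ^ k) n = lam q (k * n) := by
  simp only [lam, pow_mul]

theorem tsum_mod_three {f : ℕ → ℂ} (hf : Summable f) :
    ∑' n, f n = ∑' m, f (3 * m) + ∑' m, f (3 * m + 1) + ∑' m, f (3 * m + 2) := by
  rw [Nat.sumByResidueClasses hf 3]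
  rw [show (univ : Finset (ZMod 3)) = {0, 1, 2} from rfl]
  rw [sum_insert (by decide), sum_insert (by decide), sum_singleton]
  simp only [show (0 : ZMod 3).val = 0 from rfl, show (1 : ZMod 3).val = 1 from rfl,
    show (2 : ZMod 3).val = 2 from rfl, zero_add, add_assoc, add_comm (_ * _)]

/-- The expanded form of the Lambert series `∑ f(m) q ^ m / (1 - q ^ m)` converges absolutely. -/
theorem summable_lambert_double {q : ℂ} (hq : ‖q‖ < 1) {f : ℕ → ℂ} (hf : ∀ n, ‖f n‖ ≤ n) :
    Summable fun p : ℕ × ℕ => f p.1 * (q ^ (p.2 + 1)) ^ p.1 := by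
  have hf0 : f 0 = 0 := by simpa using hf 0
  have h1 : Summable fun n : ℕ => (n : ℝ) * ‖q‖ ^ n := by
    simpa using summable_pow_mul_geometric_of_norm_lt_one 1 (r := ‖q‖) (by simpa using hq)
  have h2 := summable_geometric_of_lt_one (norm_nonneg q) hq
  have h3 : Summable fun p : ℕ × ℕ => (p.1 : ℝ) * ‖q‖ ^ p.1 * ‖q‖ ^ p.2 :=
    h1.mul_of_nonneg h2 (fun n => by positivity) (fun n => by positivity)
  refine .of_norm_bounded h3 fun p => ?_
  rcases p with ⟨m, k⟩
  rcases Nat.eq_zero_or_pos m with rfl | hm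
  · simp [hf0]
  have h4 : m + k ≤ (k + 1) * m := by nlinarith
  have h5 : (‖q‖ ^ (k + 1)) ^ m ≤ ‖q‖ ^ m * ‖q‖ ^ k := by
    rw [← pow_mul, ← pow_add]
    exact pow_le_pow_of_le_one (norm_nonneg q) hq.le h4
  rw [norm_mul, norm_pow, norm_pow]
  calc ‖f m‖ * (‖q‖ ^ (k + 1)) ^ m ≤ m * (‖q‖ ^ m * ‖q‖ ^ k) :=
        mul_le_mul (hf m) h5 (by positivity) (by positivity)
    _ = _ := by ring

/-- Rearranging a Lambert series: expand each denominator and sum over the coefficients first. -/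
theorem tsum_mul_lam {q : ℂ} (hq : ‖q‖ < 1) {f : ℕ → ℂ} (hf : ∀ n, ‖f n‖ ≤ n) :
    ∑' m, f m * lam q m = ∑' k : ℕ, ∑' m, f m * (q ^ (k + 1)) ^ m := by
  have hf0 : f 0 = 0 := by simpa using hf 0
  have hs : Summable (Function.uncurry fun k m : ℕ => f m * (q ^ (k + 1)) ^ m) :=
    (summable_lambert_double hq hf).prod_symm.congr fun p => rfl
  rw [← hs.tsum_comm]
  refine tsum_congr fun m => ?_
  rcases Nat.eq_zero_or_pos m with rfl | hm
  · simp [hf0]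
  have hm1 := norm_pow_lt_one hq hm.ne'
  have : ∀ k : ℕ, f m * (q ^ (k + 1)) ^ m = f m * q ^ m * (q ^ m) ^ k := fun k => by ring
  simp_rw [this]
  rw [tsum_mul_left, tsum_geometric_of_norm_lt_one hm1, lam]
  ring

theorem tsum_chi_mul_pow {t : ℂ} (ht : ‖t‖ < 1) :
    ∑' m, chi m * t ^ m = t / (1 + t + t ^ 2) := by
  have hs : Summable fun m => chi m * t ^ m := by
    refine .of_norm_bounded (summable_geometric_of_lt_one (norm_nonneg t) ht) fun m => ?_
    rw [norm_mul, norm_pow]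
    exact mul_le_of_le_one_left (by positivity) (norm_chi_le m)
  have e0 : ∀ m, chi (3 * m) = 0 := fun m => by simp [chi]
  have e1 : ∀ m, chi (3 * m + 1) = 1 := fun m => by simp [chi, Nat.add_mod]
  have e2 : ∀ m, chi (3 * m + 2) = -1 := fun m => by simp [chi, Nat.add_mod]
  rw [tsum_mod_three hs]
  simp only [e0, e1, e2, zero_mul, tsum_zero, zero_add, one_mul, pow_add, pow_mul, neg_mul,
    pow_one, tsum_neg, tsum_mul_right]
  rw [tsum_geometric_of_norm_lt_one (norm_pow_lt_one ht three_ne_zero)]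
  have h1 := one_sub_pow_ne_zero ht three_ne_zero
  have h2 : 1 + t + t ^ 2 ≠ 0 := by
    intro h
    apply h1
    linear_combination (1 - t) * h
  field_simp
  ring

theorem lamChi_eq {q : ℂ} (hq : ‖q‖ < 1) :
    lamChi q = ∑' k : ℕ, q ^ (k + 1) / (1 + q ^ (k + 1) + (q ^ (k + 1)) ^ 2) := by
  rw [lamChi, tsum_mul_lam hq]
  · exact tsum_congr fun k => tsum_chi_mul_pow (norm_pow_lt_one hq k.succ_ne_zero)
  · intro n
    rcases Nat.eq_zero_or_pos n with rfl | hn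
    · simp
    · exact (norm_chi_le n).trans (by exact_mod_cast hn)

theorem summable_lam_sq {q : ℂ} (hq : ‖q‖ < 1) : Summable fun n => lam q n ^ 2 := by
  have h := summable_norm_lam hq
  have := h.mul_norm h
  have h2 := this.comp_injective (i := fun n : ℕ => (n, n)) fun a b hab => (Prod.mk.inj hab).1
  refine Summable.of_norm (h2.congr fun n => ?_)
  simp [sq]

theorem lamId_eq {q : ℂ} (hq : ‖q‖ < 1) : lamId q = ∑' n, (lam q n + lam q n ^ 2) := by
  have hs : Summable fun n => lam q n + lam q n ^ 2 :=
    (summable_norm_lam hq).of_norm.add (summable_lam_sq hq)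
  rw [lamId, tsum_mul_lam hq (fun n => by simp), hs.tsum_eq_zero_add]
  simp only [lam_zero, ne_eq, OfNat.ofNat_ne_zero, not_false_eq_true, zero_pow, add_zero, zero_add]
  refine tsum_congr fun k => ?_
  rw [tsum_coe_mul_geometric_of_norm_lt_one (norm_pow_lt_one hq k.succ_ne_zero), lam]
  have := one_sub_pow_ne_zero hq k.succ_ne_zero
  field_simp
  ring

/-- The square of the cubic theta function is an Eisenstein series of weight two. -/
theorem cubicA_sq {q : ℂ} (hq : ‖q‖ < 1) :
    cubicA q ^ 2 = 1 + 12 * (lamId q - 3 * lamId (q ^ 3)) := by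
  have hq3 := norm_pow_lt_one hq three_ne_zero
  have hId : ∀ {q : ℂ}, ‖q‖ < 1 → Summable fun n : ℕ => (n : ℂ) * lam q n := fun hq => by
    refine Summable.of_norm ((summable_nat_mul_lam hq).congr fun n => ?_)
    rw [norm_mul, Complex.norm_natCast]
  have hs : Summable fun n : ℕ => (lam (q ^ 3) n + lam (q ^ 3) n ^ 2) :=
    (summable_norm_lam hq3).of_norm.add (summable_lam_sq hq3)
  have hsum : HasSum (fun n : ℕ => 6 * (lam q (3 * n) + lam q (3 * n) ^ 2) -
      3 * ((3 * n : ℕ) : ℂ) * lam q (3 * n)) (6 * lamId (q ^ 3) - 9 * lamId (q ^ 3)) := by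
    have h1 := hs.hasSum
    rw [← lamId_eq hq3] at h1
    refine ((h1.mul_left 6).sub ((hId hq3).hasSum.mul_left 9)).congr_fun fun n => ?_
    rw [lam_pow]
    push_cast
    ring
  have hinj : Function.Injective fun m : ℕ => 3 * m := fun a b h => by
    simp only at h; omega
  have hsum' : HasSum (fun n : ℕ => if 3 ∣ n then 6 * (lam q n + lam q n ^ 2) -
      3 * (n : ℂ) * lam q n else 0) (6 * lamId (q ^ 3) - 9 * lamId (q ^ 3)) := by
    refine (hinj.hasSum_iff fun n hn => if_neg fun ⟨m, hm⟩ => hn ⟨m, hm.symm⟩).1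
      (hsum.congr_fun fun n => ?_)
    exact if_pos (dvd_mul_right 3 n)
  have key := lamChi_sq hq
  have hall := (hsum'.add (hId hq).hasSum).tsum_eq
  have hcongr : ∀ n : ℕ, (2 * (lam q n + lam q n ^ 2) * (1 + cos3 n) - n * lam q n * cos3 n) =
      (if 3 ∣ n then 6 * (lam q n + lam q n ^ 2) - 3 * (n : ℂ) * lam q n else 0) +
        n * lam q n := by
    intro n
    by_cases h : 3 ∣ n
    · rw [if_pos h, cos3, if_pos (Nat.mod_eq_zero_of_dvd h)]; ring
    · rw [if_neg h, cos3, if_neg fun h' => h (Nat.dvd_of_mod_eq_zero h')]; ring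
  rw [tsum_congr hcongr, hall] at key
  rw [cubicA, lamId, lamId] at *
  linear_combination 12 * key

/-! ### Two products as combinations of cubic theta functions -/

theorem exists_cube_root : ∃ w : ℂ, 1 + w + w ^ 2 = 0 := by
  obtain ⟨w, hw⟩ := IsAlgClosed.exists_root (Polynomial.X ^ 2 + Polynomial.X + 1 : Polynomial ℂ)
    (by
      have : (Polynomial.X ^ 2 + Polynomial.X + 1 : Polynomial ℂ).degree = 2 := by compute_degree!
      rw [this]; norm_num)
  exact ⟨w, by
    simp only [Polynomial.IsRoot.def, Polynomial.eval_add, Polynomial.eval_pow, Polynomial.eval_X,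
      Polynomial.eval_one] at hw
    linear_combination hw⟩

/-- `kron_limit` at a primitive cube root of unity `w`, where `(1 - w t) (1 - w⁻¹ t) = 1 + t + t²`;
the sign `(-1) ^ n` separates the even from the odd exponents. -/
theorem phi_cube_div {q : ℂ} (hq0 : q ≠ 0) (hq : ‖q‖ < 1) :
    phi q ^ 3 = phi (q ^ 3) * (2 * cubicA (q ^ 2) - cubicA q) := by
  obtain ⟨w, hw⟩ := exists_cube_root
  have hw0 : w ≠ 0 := by rintro rfl; simp at hw
  have hw1 : w ≠ 1 := by rintro rfl; norm_num at hw
  have hwi : w⁻¹ = -1 - w := by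
    refine inv_eq_of_mul_eq_one_right ?_
    linear_combination -hw
  have hfac : ∀ t : ℂ, (1 - w * t) * (1 - w⁻¹ * t) = 1 + t + t ^ 2 := fun t => by
    rw [hwi]; linear_combination -t ^ 2 * hw
  have hfac' : ∀ t : ℂ, (1 + w * t) * (1 + w⁻¹ * t) = 1 - t + t ^ 2 := fun t => by
    rw [hwi]; linear_combination -t ^ 2 * hw
  have hp : ∀ {t : ℂ}, ‖t‖ < 1 → 1 + t + t ^ 2 ≠ 0 := fun {t} ht h =>
    one_sub_pow_ne_zero ht three_ne_zero (by linear_combination (1 - t) * h)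
  have hkron : ∀ {t : ℂ}, ‖t‖ < 1 → kron w t = (w - w⁻¹) * (t / (1 + t + t ^ 2)) := by
    intro t ht
    have h0 := hp ht
    have h := hfac t
    rw [← h] at h0 ⊢
    have h1 := left_ne_zero_of_mul h0
    have h2 := right_ne_zero_of_mul h0
    rw [kron, div_sub_div _ _ h1 h2]
    field_simp
    ring
  have hqn : ∀ n : ℕ, ‖q ^ (n + 1)‖ < 1 := fun n => norm_pow_lt_one hq n.succ_ne_zero
  have hq2 := norm_pow_lt_one hq two_ne_zero
  have hq3 := norm_pow_lt_one hq three_ne_zero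
  have hq6 := norm_pow_lt_one hq (k := 6) (by norm_num)
  have h1 : ∀ n : ℕ, 1 - w * q ^ (n + 1) ≠ 0 := fun n h => hp (hqn n) (by
    rw [← hfac, h, zero_mul])
  have h2 : ∀ n : ℕ, 1 - w⁻¹ * q ^ (n + 1) ≠ 0 := fun n h => hp (hqn n) (by
    rw [← hfac, h, mul_zero])
  have hprod : ∀ N, ∏ n ∈ range N, kronFactor w (q ^ (n + 1)) =
      qFac (q ^ 6) N * qFac q N ^ 2 / (qFac (q ^ 3) N ^ 2 * qFac (q ^ 2) N) := by
    intro N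
    simp only [qFac]
    rw [← prod_pow, ← prod_pow, ← prod_mul_distrib, ← prod_mul_distrib, ← prod_div_distrib]
    refine prod_congr rfl fun n _ => ?_
    rw [kronFactor, hfac, hfac', pow_right_comm q 2, pow_right_comm q 3, pow_right_comm q 6]
    have ht := hqn n
    generalize q ^ (n + 1) = t at ht
    have a1 := hp ht
    have a2 := one_sub_pow_ne_zero ht two_ne_zero
    have a3 := one_sub_pow_ne_zero ht three_ne_zero
    rw [div_eq_div_iff a1 (mul_ne_zero (pow_ne_zero _ a3) a2)]
    ring
  have hlim : Tendsto (fun N => (1 + w) / (1 - w) * ∏ n ∈ range N, kronFactor w (q ^ (n + 1)))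
      atTop (𝓝 ((1 + w) / (1 - w) * (phi q / phi (q ^ 3)))) := by
    simp only [hprod]
    have e : phi q / phi (q ^ 3) = eulerProduct (q ^ 6) * eulerProduct q ^ 2 /
        (eulerProduct (q ^ 3) ^ 2 * eulerProduct (q ^ 2)) := by
      rw [phi, phi, ← pow_mul]
      have := eulerProduct_ne_zero hq2
      have := eulerProduct_ne_zero hq3
      have := eulerProduct_ne_zero hq6
      norm_num
      field_simp
    rw [e]
    exact (((tendsto_qFac hq6).mul ((tendsto_qFac hq).pow 2)).div
      (((tendsto_qFac hq3).pow 2).mul (tendsto_qFac hq2)) (mul_ne_zero (pow_ne_zero _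
        (eulerProduct_ne_zero hq3)) (eulerProduct_ne_zero hq2))).const_mul _
  have key := kron_limit hq0 hq hw0 hw1 h1 h2 hlim
  -- the alternating series in terms of the series for `q` and `q ^ 2`
  have halt : ∑' n : ℕ, (-1) ^ (n + 1) * kron w (q ^ (n + 1)) =
      (w - w⁻¹) * (2 * lamChi (q ^ 2) - lamChi q) := by
    have hs : Summable fun n => kron w (q ^ (n + 1)) := (summable_norm_kron hq w).of_norm
    have e1 : (w - w⁻¹) * lamChi q = ∑' n : ℕ, kron w (q ^ (n + 1)) := by
      rw [lamChi_eq hq, ← tsum_mul_left]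
      exact tsum_congr fun n => (hkron (hqn n)).symm
    have hinj : Function.Injective fun m : ℕ => 2 * m + 1 := fun a b h => by
      simp only at h; omega
    have e2 : HasSum (fun n : ℕ => if n % 2 = 1 then kron w (q ^ (n + 1)) else 0)
        ((w - w⁻¹) * lamChi (q ^ 2)) := by
      refine (hinj.hasSum_iff fun n hn => if_neg fun h => hn ⟨n / 2, ?_⟩).1 ?_
      · show 2 * (n / 2) + 1 = n
        omega
      have hs2 : Summable fun n => kron w ((q ^ 2) ^ (n + 1)) := (summable_norm_kron hq2 w).of_norm
      have : (w - w⁻¹) * lamChi (q ^ 2) = ∑' n : ℕ, kron w ((q ^ 2) ^ (n + 1)) := by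
        rw [lamChi_eq hq2, ← tsum_mul_left]
        exact tsum_congr fun n => (hkron (norm_pow_lt_one hq2 n.succ_ne_zero)).symm
      rw [this]
      refine hs2.hasSum.congr_fun fun n => ?_
      simp only [Function.comp_apply]
      rw [if_pos (by omega), ← pow_mul, show 2 * (n + 1) = 2 * n + 1 + 1 by ring]
    rw [mul_sub, e1]
    have := ((e2.mul_left 2).sub hs.hasSum).tsum_eq
    rw [mul_left_comm, ← this]
    refine tsum_congr fun n => ?_
    rcases Nat.mod_two_eq_zero_or_one n with h | h
    · rw [if_neg (by omega), Odd.neg_one_pow (by rw [Nat.odd_iff]; omega)]; ring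
    · rw [if_pos h, Even.neg_one_pow (by rw [Nat.even_iff]; omega)]; ring
  have hww : w - w⁻¹ = 3 * ((1 + w) / (1 - w)) := by
    have : 1 - w ≠ 0 := sub_ne_zero.2 hw1.symm
    rw [hwi]
    field_simp
    linear_combination -2 * hw
  have hz : (1 + w) / (1 - w) ≠ 0 := by
    refine div_ne_zero (fun h => ?_) (sub_ne_zero.2 hw1.symm)
    have : w ^ 2 = 0 := by linear_combination hw - h
    exact hw0 (pow_eq_zero_iff two_ne_zero |>.1 this)
  have hx := phi_ne_zero hq
  have hy := phi_ne_zero hq3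
  rw [halt, hww, show eulerProduct (q ^ 2) / eulerProduct q ^ 2 = (phi q)⁻¹ by simp [phi]] at key
  have key2 : phi q / phi (q ^ 3) = (phi q)⁻¹ ^ 2 * (2 * cubicA (q ^ 2) - cubicA q) := by
    apply mul_left_cancel₀ hz
    rw [key, cubicA, cubicA]
    ring
  field_simp at key2
  linear_combination key2

/-- `kron_limit` for the base `q ^ 3` at `z = q`; the Lambert series then runs over the exponents
prime to `3`, with the signs `(-1) ^ (n + 1) χ(n)`. -/
theorem three_mul_phi_cube_div {q : ℂ} (hq0 : q ≠ 0) (hq : ‖q‖ < 1) :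
    3 * phi (q ^ 3) ^ 3 = phi q * (cubicA q + 2 * cubicA (q ^ 2)) := by
  have hq2 := norm_pow_lt_one hq two_ne_zero
  have hq3 := norm_pow_lt_one hq three_ne_zero
  have hq1 : q ≠ 1 := by rintro rfl; simp at hq
  have h1q : 1 - q ≠ 0 := sub_ne_zero.2 hq1.symm
  have e1 : ∀ n : ℕ, q * (q ^ 3) ^ (n + 1) = q ^ (3 * n + 4) := fun n => by ring
  have e2 : ∀ n : ℕ, q⁻¹ * (q ^ 3) ^ (n + 1) = q ^ (3 * n + 2) := fun n => by
    field_simp; ring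
  have h1 : ∀ n : ℕ, 1 - q * (q ^ 3) ^ (n + 1) ≠ 0 := fun n => by
    rw [e1]; exact one_sub_pow_ne_zero hq (by omega)
  have h2 : ∀ n : ℕ, 1 - q⁻¹ * (q ^ 3) ^ (n + 1) ≠ 0 := fun n => by
    rw [e2]; exact one_sub_pow_ne_zero hq (by omega)
  -- the product runs over the exponents prime to `3`
  have hprod : ∀ N, (1 + q) / (1 - q) * ∏ n ∈ range N, kronFactor q ((q ^ 3) ^ (n + 1)) =
      qRat q (3 * N + 1) / qRat (q ^ 3) N := by
    intro N
    have hne : ∀ N, qRat (q ^ 3) N ≠ 0 := fun N => prod_ne_zero_iff.2 fun n _ => div_ne_zero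
      (one_add_pow_ne_zero hq3 n.succ_ne_zero) (one_sub_pow_ne_zero hq3 n.succ_ne_zero)
    rw [eq_div_iff (hne N)]
    induction N with
    | zero => simp [qRat]
    | succ N ih =>
      have s1 : qRat q (3 * (N + 1) + 1) = qRat q (3 * N + 1) *
          ((1 + q ^ (3 * N + 2)) / (1 - q ^ (3 * N + 2))) *
          ((1 + q ^ (3 * N + 3)) / (1 - q ^ (3 * N + 3))) *
          ((1 + q ^ (3 * N + 4)) / (1 - q ^ (3 * N + 4))) := by
        simp only [qRat]
        rw [show 3 * (N + 1) + 1 = 3 * N + 1 + 1 + 1 + 1 by ring, prod_range_succ, prod_range_succ,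
          prod_range_succ]
      have s2 : qRat (q ^ 3) (N + 1) = qRat (q ^ 3) N *
          ((1 + q ^ (3 * N + 3)) / (1 - q ^ (3 * N + 3))) := by
        simp only [qRat]
        rw [prod_range_succ, ← pow_mul, show 3 * (N + 1) = 3 * N + 3 by ring]
      rw [prod_range_succ, s1, s2, ← ih, kronFactor, e1, e2]
      have a1 := one_sub_pow_ne_zero hq (k := 3 * N + 2) (by omega)
      have a2 := one_sub_pow_ne_zero hq (k := 3 * N + 3) (by omega)
      have a3 := one_sub_pow_ne_zero hq (k := 3 * N + 4) (by omega)
      field_simp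
  have hlim : Tendsto (fun N => (1 + q) / (1 - q) *
      ∏ n ∈ range N, kronFactor q ((q ^ 3) ^ (n + 1))) atTop (𝓝 ((phi q)⁻¹ / (phi (q ^ 3))⁻¹)) := by
    simp only [hprod]
    refine Tendsto.div ((tendsto_qRat_phi hq).comp ?_) (tendsto_qRat_phi hq3)
      (inv_ne_zero (phi_ne_zero hq3))
    exact tendsto_atTop_mono (fun N => by show N ≤ 3 * N + 1; omega) tendsto_id
  have key := kron_limit (pow_ne_zero 3 hq0) hq3 hq0 hq1 h1 h2 hlim
  have hk : ∀ n : ℕ, kron q ((q ^ 3) ^ (n + 1)) = lam q (3 * n + 4) - lam q (3 * n + 2) := by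
    intro n; rw [kron, e1, e2, lam, lam]
  -- the Lambert series with the coefficients `(-1) ^ (n + 1) χ(n)`
  have hs : Summable fun n => chi n * lam q n := (summable_chi_lam hq).of_norm
  have hs2 : Summable fun n => chi n * lam (q ^ 2) n := (summable_chi_lam hq2).of_norm
  have hinj : Function.Injective fun m : ℕ => 2 * m := fun a b h => by
    simp only at h; omega
  have hchi2 : ∀ m, chi (2 * m) = -chi m := by
    intro m
    have hm : m % 3 < 3 := Nat.mod_lt _ (by norm_num)
    unfold chi
    rw [Nat.mul_mod]
    interval_cases m % 3 <;> norm_num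
  have heven : HasSum (fun n : ℕ => if 2 ∣ n then chi n * lam q n else 0)
      (-lamChi (q ^ 2)) := by
    refine (hinj.hasSum_iff fun n hn => if_neg fun ⟨m, hm⟩ => hn ⟨m, hm.symm⟩).1
      (hs2.hasSum.neg.congr_fun fun n => ?_)
    simp only [Function.comp_apply]
    rw [if_pos (dvd_mul_right 2 n), hchi2, lam_pow]
    ring
  have hall : HasSum (fun n : ℕ => (-1) ^ (n + 1) * (chi n * lam q n))
      (lamChi q + 2 * lamChi (q ^ 2)) := by
    have := hs.hasSum.sub (heven.mul_left 2)
    rw [mul_neg, sub_neg_eq_add] at this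
    refine this.congr_fun fun n => ?_
    by_cases h : 2 ∣ n
    · rw [if_pos h, Odd.neg_one_pow (by rw [Nat.odd_iff]; omega)]; ring
    · rw [if_neg h, Even.neg_one_pow (by rw [Nat.even_iff]; omega)]; ring
  have f0 : ∀ m, chi (3 * m) = 0 := fun m => by simp [chi]
  have f1 : ∀ m, chi (3 * m + 1) = 1 := fun m => by simp [chi, Nat.add_mod]
  have f2 : ∀ m, chi (3 * m + 2) = -1 := fun m => by simp [chi, Nat.add_mod]
  have g1 : ∀ m : ℕ, (-1 : ℂ) ^ (3 * m + 1 + 1) = (-1) ^ m := fun m => by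
    rw [pow_add, pow_add, pow_mul]; norm_num
  have g2 : ∀ m : ℕ, (-1 : ℂ) ^ (3 * m + 2 + 1) = -(-1) ^ m := fun m => by
    rw [pow_add, pow_add, pow_mul]; norm_num
  have hsplit := tsum_mod_three hall.summable
  rw [hall.tsum_eq] at hsplit
  simp only [f0, f1, f2, g1, g2, zero_mul, mul_zero, tsum_zero, zero_add, one_mul, neg_mul,
    mul_neg, neg_neg] at hsplit
  have hsub : ∀ {g : ℕ → ℕ}, Function.Injective g → ∀ {e : ℕ → ℂ}, (∀ n, ‖e n‖ = 1) →
      Summable fun m : ℕ => e m * lam q (g m) := fun hg e he => by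
    refine Summable.of_norm (((summable_norm_lam hq).comp_injective hg).congr fun n => ?_)
    simp [he]
  have hsgn : ∀ n : ℕ, ‖(-1 : ℂ) ^ n‖ = 1 := fun n => by simp
  have t1 : Summable fun m : ℕ => (-1 : ℂ) ^ m * lam q (3 * m + 1) :=
    hsub (fun a b h => by omega) hsgn
  have t2 : Summable fun m : ℕ => (-1 : ℂ) ^ m * lam q (3 * m + 2) :=
    hsub (fun a b h => by omega) hsgn
  have t3 : Summable fun m : ℕ => (-1 : ℂ) ^ (m + 1) * lam q (3 * m + 4) :=
    hsub (e := fun m => (-1) ^ (m + 1)) (fun a b h => by omega) (fun n => hsgn _)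
  have hser : ∑' n : ℕ, (-1) ^ (n + 1) * kron q ((q ^ 3) ^ (n + 1)) =
      lamChi q + 2 * lamChi (q ^ 2) - lam q 1 := by
    rw [hsplit, t1.tsum_eq_zero_add]
    have : ∀ n : ℕ, (-1) ^ (n + 1) * kron q ((q ^ 3) ^ (n + 1)) =
        (-1) ^ (n + 1) * lam q (3 * n + 4) + (-1) ^ n * lam q (3 * n + 2) := fun n => by
      rw [hk]; ring
    rw [tsum_congr this, t3.tsum_add t2]
    simp only [pow_zero, mul_zero, zero_add, one_mul, mul_add, mul_one, add_assoc]
    norm_num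
  have hx := phi_ne_zero hq
  have hy := phi_ne_zero hq3
  rw [hser, show eulerProduct ((q ^ 3) ^ 2) / eulerProduct (q ^ 3) ^ 2 = (phi (q ^ 3))⁻¹ by
    simp [phi], show (1 + q) / (1 - q) = 1 + 2 * lam q 1 by rw [lam, pow_one]; field_simp; ring]
    at key
  field_simp at key
  rw [cubicA, cubicA]
  linear_combination 3 * key

/-! ### The Jacobi triple product -/

/-- The Gaussian binomial coefficients, defined by their Pascal recursion. -/
noncomputable def gaussBinom (q : ℂ) : ℕ → ℕ → ℂ
  | _, 0 => 1
  | 0, _ + 1 => 0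
  | n + 1, k + 1 => q ^ (k + 1) * gaussBinom q n (k + 1) + gaussBinom q n k

@[simp] theorem gaussBinom_zero_right (q : ℂ) (n : ℕ) : gaussBinom q n 0 = 1 := by
  cases n <;> rfl

theorem gaussBinom_succ_succ (q : ℂ) (n k : ℕ) : gaussBinom q (n + 1) (k + 1) =
    q ^ (k + 1) * gaussBinom q n (k + 1) + gaussBinom q n k := rfl

theorem gaussBinom_eq_zero (q : ℂ) : ∀ {n k : ℕ}, n < k → gaussBinom q n k = 0
  | 0, _ + 1, _ => rfl
  | n + 1, k + 1, h => by
    rw [gaussBinom_succ_succ, gaussBinom_eq_zero q (by omega : n < k + 1),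
      gaussBinom_eq_zero q (by omega : n < k), mul_zero, add_zero]

/-- The closed form of the Gaussian binomial coefficients, without division. -/
theorem gaussBinom_mul (q : ℂ) (j k : ℕ) :
    gaussBinom q (j + k) j * (qFac q j * qFac q k) = qFac q (j + k) := by
  induction j generalizing k with
  | zero => simp [qFac]
  | succ j ihj =>
    induction k with
    | zero =>
      have h := ihj 0
      simp only [add_zero] at h ⊢
      rw [gaussBinom_succ_succ, gaussBinom_eq_zero q (Nat.lt_succ_self j), mul_zero, zero_add,
        qFac_succ]
      linear_combination (1 - q ^ (j + 1)) * h
    | succ k ihk =>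
      have h := ihj (k + 1)
      rw [show j + 1 + (k + 1) = (j + (k + 1)) + 1 by ring, gaussBinom_succ_succ, qFac_succ q (j + _)]
      rw [show j + 1 + k = j + (k + 1) by ring] at ihk
      rw [qFac_succ q j] at *
      rw [qFac_succ q k] at *
      linear_combination (q ^ (j + 1) * (1 - q ^ (k + 1))) * ihk + (1 - q ^ (j + 1)) * h

/-- The finite `q`-binomial theorem. -/
theorem prod_one_add_mul_pow (q x : ℂ) (M : ℕ) : ∏ i ∈ range M, (1 + x * q ^ i) =
    ∑ j ∈ range (M + 1), gaussBinom q M j * q ^ j.choose 2 * x ^ j := by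
  induction M generalizing x with
  | zero => simp
  | succ M ih =>
    have h : ∀ i, 1 + x * q ^ (i + 1) = 1 + (x * q) * q ^ i := fun i => by ring
    rw [prod_range_succ', prod_congr rfl fun i _ => h i, ih, sum_range_succ' _ (M + 1)]
    have e : ∀ j ∈ range (M + 1), gaussBinom q (M + 1) (j + 1) * q ^ (j + 1).choose 2 * x ^ (j + 1) =
        gaussBinom q M (j + 1) * q ^ (j + 1).choose 2 * (x * q) ^ (j + 1) +
          x * (gaussBinom q M j * q ^ j.choose 2 * (x * q) ^ j) := by
      intro j _
      have : (j + 1).choose 2 = j + j.choose 2 := by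
        rw [Nat.choose_succ_succ' j 1, Nat.choose_one_right]
      rw [gaussBinom_succ_succ, this, pow_add]
      ring
    rw [sum_congr rfl e, sum_add_distrib, ← mul_sum]
    have e2 := sum_range_succ' (fun j => gaussBinom q M j * q ^ j.choose 2 * (x * q) ^ j) (M + 1)
    rw [sum_range_succ, gaussBinom_eq_zero q (Nat.lt_succ_self M)] at e2
    simp only [gaussBinom_zero_right, pow_zero, mul_one, zero_mul, add_zero] at *
    linear_combination e2

theorem choose_two_add (N n : ℕ) :
    (N + 1 + n).choose 2 + (N + 1).choose 2 = N * (N + 1 + n) + (n + 1).choose 2 := by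
  have h : (((N + 1 + n).choose 2 + (N + 1).choose 2 : ℕ) : ℚ) =
      ((N * (N + 1 + n) + (n + 1).choose 2 : ℕ) : ℚ) := by
    push_cast [Nat.cast_choose_two]
    ring
  exact_mod_cast h

theorem choose_two_sub (n m : ℕ) :
    m.choose 2 + (n + m + 1).choose 2 = (n + m) * m + (n + 1).choose 2 := by
  have h : ((m.choose 2 + (n + m + 1).choose 2 : ℕ) : ℚ) =
      (((n + m) * m + (n + 1).choose 2 : ℕ) : ℚ) := by
    push_cast [Nat.cast_choose_two]
    ring
  exact_mod_cast h

/-- The finite form of the triple product, symmetric under `n ↦ -1 - n`. -/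
theorem triple_product_finite {q : ℂ} (hq0 : q ≠ 0) (hq : ‖q‖ < 1) {z : ℂ} (hz : z ≠ 0) (N : ℕ) :
    (1 + z) * ∏ n ∈ range N, ((1 + z * q ^ (n + 1)) * (1 + z⁻¹ * q ^ (n + 1))) =
      ∑ n ∈ range (N + 1), qFac q (2 * N + 1) / (qFac q (N - n) * qFac q (N + 1 + n)) *
        (q ^ (n + 1).choose 2 * (z ^ (n + 1) + z⁻¹ ^ n)) := by
  have hqN : q ^ N ≠ 0 := pow_ne_zero _ hq0
  have hF := qFac_ne_zero hq
  -- the base point that puts the factor `1 + z` into the middle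
  set x := z / q ^ N with hx
  have hmid : x * q ^ N = z := by rw [hx]; field_simp
  have hup : ∀ n, x * q ^ (N + 1 + n) = z * q ^ (n + 1) := fun n => by
    rw [hx, show N + 1 + n = N + (n + 1) by ring, pow_add]; field_simp
  have hdown : ∀ n ∈ range N, x * q ^ (N - 1 - n) = z / q ^ (n + 1) := fun n hn => by
    have hn := mem_range.1 hn
    rw [eq_div_iff (pow_ne_zero _ hq0), mul_assoc, ← pow_add,
      show N - 1 - n + (n + 1) = N by omega, hmid]
  have key := prod_one_add_mul_pow q x (2 * N + 1)
  -- the factor that turns `1 + z / q ^ n` into `1 + q ^ n / z`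
  have hK : ∏ n ∈ range N, (q ^ (n + 1) / z) = q ^ (N + 1).choose 2 / z ^ N := by
    rw [prod_div_distrib, prod_const, card_range, prod_pow_eq_pow_sum]
    congr 2
    have := sum_range_id_mul_two (N + 1)
    rw [sum_range_succ'] at this
    have h2 := Nat.choose_two_right (N + 1)
    simp only [Nat.add_sub_cancel, add_zero] at this h2
    omega
  have hP : ∀ n ∈ range N, (q ^ (n + 1) / z) *
      ((1 + x * q ^ (N + 1 + n)) * (1 + x * q ^ (N - 1 - n))) =
      (1 + z * q ^ (n + 1)) * (1 + z⁻¹ * q ^ (n + 1)) := by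
    intro n hn
    rw [hup, hdown n hn]
    have := pow_ne_zero (n + 1) hq0
    field_simp
    ring
  rw [prod_range_two_mul_add_one, hmid] at key
  rw [← prod_congr rfl hP, prod_mul_distrib, hK, mul_left_comm, key,
    show 2 * N + 1 + 1 = (N + 1) + (N + 1) by ring, sum_range_add, ← sum_range_reflect,
    ← sum_add_distrib, mul_sum]
  refine sum_congr rfl fun n hn => ?_
  obtain ⟨m, rfl⟩ := Nat.exists_eq_add_of_le (Nat.lt_succ_iff.1 (mem_range.1 hn))
  have c1 : gaussBinom q (2 * (n + m) + 1) m =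
      qFac q (2 * (n + m) + 1) / (qFac q m * qFac q (n + m + 1 + n)) := by
    rw [eq_div_iff (mul_ne_zero (hF _) (hF _))]
    have := gaussBinom_mul q m (n + m + 1 + n)
    rwa [show m + (n + m + 1 + n) = 2 * (n + m) + 1 by ring] at this
  have c2 : gaussBinom q (2 * (n + m) + 1) (n + m + 1 + n) =
      qFac q (2 * (n + m) + 1) / (qFac q m * qFac q (n + m + 1 + n)) := by
    rw [eq_div_iff (mul_ne_zero (hF _) (hF _))]
    have := gaussBinom_mul q (n + m + 1 + n) m
    rwa [show n + m + 1 + n + m = 2 * (n + m) + 1 by ring, mul_comm (qFac q (n + m + 1 + n))] at this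
  have p1 : q ^ (n + m + 1).choose 2 / z ^ (n + m) * (q ^ m.choose 2 * x ^ m) =
      q ^ (n + 1).choose 2 * z⁻¹ ^ n := by
    have h := congrArg (q ^ ·) (choose_two_sub n m)
    simp only [pow_add, pow_mul] at h
    rw [hx, div_pow, inv_pow, pow_add z]
    field_simp
    rw [pow_add q]
    linear_combination h
  have p2 : q ^ (n + m + 1).choose 2 / z ^ (n + m) *
      (q ^ (n + m + 1 + n).choose 2 * x ^ (n + m + 1 + n)) =
      q ^ (n + 1).choose 2 * z ^ (n + 1) := by
    have h := congrArg (q ^ ·) (choose_two_add (n + m) n)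
    simp only [pow_add q (Nat.choose _ _), pow_add q (_ * _), pow_mul q (n + m)] at h
    rw [hx, div_pow, show z ^ (n + m + 1 + n) = z ^ (n + m) * z ^ (n + 1) by ring]
    field_simp
    linear_combination h
  rw [show n + m + 1 - 1 - n = m by omega, show n + m - n = m by omega, c1, c2]
  linear_combination (qFac q (2 * (n + m) + 1) / (qFac q m * qFac q (n + m + 1 + n))) * (p1 + p2)

/-- The Jacobi triple product for `‖z‖ = 1`, with the terms of index `n` and `-1 - n` of the theta
series taken together. -/
theorem triple_product {q : ℂ} (hq0 : q ≠ 0) (hq : ‖q‖ < 1) {z : ℂ} (hz : ‖z‖ = 1) {S : ℂ}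
    (hS : Tendsto (fun N => qFac q N *
      ∏ n ∈ range N, ((1 + z * q ^ (n + 1)) * (1 + z⁻¹ * q ^ (n + 1)))) atTop (𝓝 S)) :
    ∑' n : ℕ, q ^ (n + 1).choose 2 * (z ^ (n + 1) + z⁻¹ ^ n) = (1 + z) * S := by
  have hz0 : z ≠ 0 := by rintro rfl; simp at hz
  have hT := tendsto_qFac hq
  have hE := eulerProduct_ne_zero hq
  have hI := hT.inv₀ hE
  obtain ⟨C, hC0, hC⟩ := exists_norm_le_of_tendsto hT
  obtain ⟨D, hD0, hD⟩ := exists_norm_le_of_tendsto hI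
  have hsum : Tendsto (fun N => ∑' n : ℕ, if n ∈ range (N + 1) then
      (qFac q N * (qFac q (2 * N + 1) * ((qFac q (N - n))⁻¹ * (qFac q (N + 1 + n))⁻¹))) *
        (q ^ (n + 1).choose 2 * (z ^ (n + 1) + z⁻¹ ^ n)) else 0)
      atTop (𝓝 (∑' n : ℕ, (eulerProduct q * (eulerProduct q *
        ((eulerProduct q)⁻¹ * (eulerProduct q)⁻¹))) *
        (q ^ (n + 1).choose 2 * (z ^ (n + 1) + z⁻¹ ^ n)))) := by
    refine tendsto_tsum_of_dominated_convergence
      (bound := fun n => (C * (C * (D * D))) * (‖q‖ ^ n * 2))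
      (((summable_geometric_of_lt_one (norm_nonneg q) hq).mul_right 2).mul_left _) ?_ ?_
    · intro n
      have t1 : Tendsto (fun N => (qFac q (N + 1 + n))⁻¹) atTop (𝓝 (eulerProduct q)⁻¹) :=
        hI.comp (tendsto_atTop_mono (fun N => by show N ≤ N + 1 + n; omega) tendsto_id)
      have t2 : Tendsto (fun N => (qFac q (N - n))⁻¹) atTop (𝓝 (eulerProduct q)⁻¹) :=
        hI.comp (tendsto_sub_atTop_nat _)
      have t3 : Tendsto (fun N => qFac q (2 * N + 1)) atTop (𝓝 (eulerProduct q)) :=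
        hT.comp (tendsto_atTop_mono (fun N => by show N ≤ 2 * N + 1; omega) tendsto_id)
      refine Tendsto.congr' ?_ ((hT.mul (t3.mul (t2.mul t1))).mul_const _)
      filter_upwards [eventually_gt_atTop n] with N hN
      rw [if_pos (mem_range.2 (by omega))]
    · refine .of_forall fun N n => ?_
      split_ifs
      · rw [norm_mul, norm_mul, norm_mul, norm_mul, norm_mul, norm_pow]
        have b1 : ‖q‖ ^ (n + 1).choose 2 ≤ ‖q‖ ^ n := by
          refine pow_le_pow_of_le_one (norm_nonneg q) hq.le ?_
          rw [Nat.choose_succ_succ' n 1, Nat.choose_one_right]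
          omega
        have b2 : ‖z ^ (n + 1) + z⁻¹ ^ n‖ ≤ 2 := by
          refine (norm_add_le _ _).trans ?_
          rw [norm_pow, norm_pow, norm_inv, hz]
          norm_num
        gcongr
        · exact hC _
        · exact hC _
        · exact hD _
        · exact hD _
      · rw [norm_zero]; positivity
  have hval : eulerProduct q * (eulerProduct q * ((eulerProduct q)⁻¹ * (eulerProduct q)⁻¹)) = 1 := by
    field_simp
  simp only [hval, one_mul] at hsum
  refine tendsto_nhds_unique hsum ((hS.const_mul (1 + z)).congr fun N => ?_)
  rw [mul_left_comm, triple_product_finite hq0 hq hz0 N, mul_sum,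
    tsum_eq_sum (s := range (N + 1)) fun n hn => if_neg hn]
  refine sum_congr rfl fun n hn => ?_
  rw [if_pos hn, div_eq_mul_inv, mul_inv]
  ring

/-! ### The two theta constants -/

theorem nomeQ_ne_zero (τ : ℂ) : nomeQ τ ≠ 0 := Complex.exp_ne_zero _

theorem norm_nomeQ_lt_one {τ : ℂ} (hτ : 0 < τ.im) : ‖nomeQ τ‖ < 1 := by
  rw [nomeQ, Complex.norm_exp, Real.exp_lt_one_iff]
  simp
  positivity

/-- The product formula for the theta constants with upper characteristic `1`. -/
theorem thetaChar_one {τ : ℂ} (hτ : 0 < τ.im) (ε : ℝ) {S : ℂ}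
    (hS : Tendsto (fun N => qFac (nomeQ τ) N * ∏ n ∈ range N,
      (1 + 2 * Real.cos (Real.pi * ε) * nomeQ τ ^ (n + 1) + (nomeQ τ ^ (n + 1)) ^ 2))
      atTop (𝓝 S)) :
    thetaChar 1 ε 0 τ =
      Complex.exp (Real.pi * Complex.I * τ / 4) * (2 * Real.cos (Real.pi * ε / 2)) * S := by
  set z := Complex.exp (Real.pi * ε * Complex.I) with hz
  have hz0 : z ≠ 0 := Complex.exp_ne_zero _
  have hz1 : ‖z‖ = 1 := by
    rw [hz, ← Complex.ofReal_mul]; exact Complex.norm_exp_ofReal_mul_I _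
  have hzi : z⁻¹ = Complex.exp (-(Real.pi * ε) * Complex.I) := by
    rw [hz, ← Complex.exp_neg, neg_mul]
  have hcos : z + z⁻¹ = 2 * Real.cos (Real.pi * ε) := by
    rw [hzi, hz, Complex.ofReal_cos, Complex.cos]; push_cast; ring
  have hfac : ∀ t : ℂ, (1 + z * t) * (1 + z⁻¹ * t) =
      1 + 2 * Real.cos (Real.pi * ε) * t + t ^ 2 := fun t => by
    rw [← hcos]
    linear_combination t ^ 2 * mul_inv_cancel₀ hz0
  have key := triple_product (nomeQ_ne_zero τ) (norm_nomeQ_lt_one hτ) hz1 (S := S)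
    (by simpa only [hfac] using hS)
  have hsum := summable_thetaChar 1 ε 0 τ hτ
  set f : ℤ → ℂ := fun n => Complex.exp (2 * Real.pi * Complex.I *
      ((1 / 2 : ℂ) * ((n : ℂ) + ((1 : ℝ) : ℂ) / 2) ^ 2 * τ
        + ((n : ℂ) + ((1 : ℝ) : ℂ) / 2) * (0 + (ε : ℂ) / 2))) with hf
  have h1 : Summable fun n : ℕ => f n := hsum.comp_injective Nat.cast_injective
  have h2 : Summable fun n : ℕ => f (-(n + 1)) :=
    hsum.comp_injective (i := fun n : ℕ => (-(n + 1) : ℤ)) fun a b h => by simpa using h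
  have hterm : ∀ n : ℕ, f n + f (-(n + 1)) = Complex.exp (Real.pi * Complex.I * τ / 4) *
      Complex.exp (-(Real.pi * ε / 2) * Complex.I) *
      (nomeQ τ ^ (n + 1).choose 2 * (z ^ (n + 1) + z⁻¹ ^ n)) := by
    intro n
    rw [hzi, hz, nomeQ, ← Complex.exp_nat_mul, ← Complex.exp_nat_mul, ← Complex.exp_nat_mul,
      mul_add, mul_add, ← Complex.exp_add, ← Complex.exp_add, ← Complex.exp_add,
      ← Complex.exp_add, ← Complex.exp_add, hf, Nat.cast_choose_two]
    congr 2 <;> (push_cast; ring_nf)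
  have hhalf : Complex.exp (-(Real.pi * ε / 2) * Complex.I) * (1 + z) =
      2 * Real.cos (Real.pi * ε / 2) := by
    rw [hz, mul_add, mul_one, ← Complex.exp_add, Complex.ofReal_cos, Complex.cos]
    push_cast
    rw [mul_div_cancel₀ _ (two_ne_zero' ℂ), add_comm]
    congr 2
    ring
  rw [thetaChar, tsum_of_nat_of_neg_add_one h1 h2, ← h1.tsum_add h2, tsum_congr hterm,
    tsum_mul_left, key, ← hhalf]
  ring

theorem thetaChar_one_third {τ : ℂ} (hτ : 0 < τ.im) :
    thetaChar 1 (1 / 3) 0 τ = Complex.exp (Real.pi * Complex.I * τ / 4) * (Real.sqrt 3 : ℝ) *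
      eulerProduct (nomeQ τ ^ 3) := by
  have hq := norm_nomeQ_lt_one hτ
  rw [thetaChar_one hτ (1 / 3) (S := eulerProduct (nomeQ τ ^ 3))]
  · rw [show Real.pi * (1 / 3) / 2 = Real.pi / 6 by ring, Real.cos_pi_div_six]
    push_cast
    ring
  · rw [show Real.pi * (1 / 3) = Real.pi / 3 by ring, Real.cos_pi_div_three]
    refine (tendsto_qFac (norm_pow_lt_one hq three_ne_zero)).congr fun N => ?_
    simp only [qFac]
    rw [← prod_mul_distrib]
    refine prod_congr rfl fun n _ => ?_
    push_cast
    ring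

theorem thetaChar_two_thirds {τ : ℂ} (hτ : 0 < τ.im) :
    thetaChar 1 (2 / 3) 0 τ = Complex.exp (Real.pi * Complex.I * τ / 4) *
      (eulerProduct (nomeQ τ) ^ 2 * eulerProduct (nomeQ τ ^ 6) /
        (eulerProduct (nomeQ τ ^ 2) * eulerProduct (nomeQ τ ^ 3))) := by
  have hq := norm_nomeQ_lt_one hτ
  have hq2 := norm_pow_lt_one hq two_ne_zero
  have hq3 := norm_pow_lt_one hq three_ne_zero
  have hq6 := norm_pow_lt_one hq (k := 6) (by norm_num)
  rw [thetaChar_one hτ (2 / 3) (S := eulerProduct (nomeQ τ) ^ 2 * eulerProduct (nomeQ τ ^ 6) /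
        (eulerProduct (nomeQ τ ^ 2) * eulerProduct (nomeQ τ ^ 3)))]
  · rw [show Real.pi * (2 / 3) / 2 = Real.pi / 3 by ring, Real.cos_pi_div_three]
    push_cast
    ring
  · rw [show Real.pi * (2 / 3) = Real.pi - Real.pi / 3 by ring, Real.cos_pi_sub,
      Real.cos_pi_div_three]
    refine ((((tendsto_qFac hq).pow 2).mul (tendsto_qFac hq6)).div ((tendsto_qFac hq2).mul
      (tendsto_qFac hq3)) (mul_ne_zero (eulerProduct_ne_zero hq2)
        (eulerProduct_ne_zero hq3))).congr fun N => ?_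
    simp only [qFac, Pi.div_apply]
    rw [← prod_pow, ← prod_mul_distrib, ← prod_mul_distrib, ← prod_div_distrib,
      ← prod_mul_distrib]
    refine prod_congr rfl fun n _ => ?_
    rw [pow_right_comm _ 2, pow_right_comm _ 3, pow_right_comm _ 6]
    have ht := norm_pow_lt_one hq n.succ_ne_zero
    generalize nomeQ τ ^ (n + 1) = t at ht
    have a2 := one_sub_pow_ne_zero ht two_ne_zero
    have a3 := one_sub_pow_ne_zero ht three_ne_zero
    push_cast
    rw [div_eq_iff (mul_ne_zero a2 a3)]
    ring

/-! ### The logarithmic derivative -/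

theorem hasDerivAt_eulerProduct {q : ℂ} (hq0 : q ≠ 0) (hq : ‖q‖ < 1) :
    HasDerivAt eulerProduct (-lamId q * eulerProduct q / q) q := by
  have hmem : q ∈ Metric.ball (0 : ℂ) 1 := by simpa using hq
  have hE := eulerProduct_ne_zero hq
  have hdiff : DifferentiableAt ℂ eulerProduct q :=
    ModularForm.differentiableOn_tprod_one_sub_pow.differentiableAt
      (Metric.isOpen_ball.mem_nhds hmem)
  have hld : ∀ n : ℕ, logDeriv (fun x : ℂ => 1 - x ^ (n + 1)) q =
      -(((n + 1 : ℕ) : ℂ) * lam q (n + 1)) / q := by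
    intro n
    have h := one_sub_pow_ne_zero hq n.succ_ne_zero
    have hd : HasDerivAt (fun x : ℂ => 1 - x ^ (n + 1)) (-(((n + 1 : ℕ) : ℂ) * q ^ n)) q := by
      simpa using (hasDerivAt_pow (n + 1) q).const_sub 1
    rw [logDeriv_apply, hd.deriv, lam]
    field_simp
    ring
  have hs : Summable fun n : ℕ => (n : ℂ) * lam q n := by
    refine Summable.of_norm ((summable_nat_mul_lam hq).congr fun n => ?_)
    rw [norm_mul, Complex.norm_natCast]
  have hs' : Summable fun n : ℕ => ((n + 1 : ℕ) : ℂ) * lam q (n + 1) :=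
    (summable_nat_add_iff 1).2 hs
  have key := logDeriv_tprod_eq_tsum Metric.isOpen_ball hmem
    (f := fun (n : ℕ) (x : ℂ) => 1 - x ^ (n + 1))
    (fun n => one_sub_pow_ne_zero hq n.succ_ne_zero) (fun n => by fun_prop)
    (by simp only [hld]; exact (hs'.neg).div_const q)
    ModularForm.multipliableLocallyUniformlyOn_one_sub_pow hE
  simp only [hld] at key
  rw [tsum_div_const, tsum_neg] at key
  have hId : lamId q = ∑' n : ℕ, ((n + 1 : ℕ) : ℂ) * lam q (n + 1) := by
    rw [lamId, hs.tsum_eq_zero_add]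
    simp
  rw [← hId] at key
  have hder : deriv eulerProduct q = -lamId q * eulerProduct q / q := by
    have h : logDeriv eulerProduct q = -lamId q / q := key
    rw [logDeriv_apply, div_eq_iff hE] at h
    rw [h]
    ring
  rw [← hder]
  exact hdiff.hasDerivAt

theorem hasDerivAt_eulerProduct_pow {q : ℂ} (hq0 : q ≠ 0) (hq : ‖q‖ < 1) {k : ℕ} (hk : k ≠ 0) :
    HasDerivAt (fun x => eulerProduct (x ^ k))
      (-(k : ℂ) * lamId (q ^ k) * eulerProduct (q ^ k) / q) q := by
  have h := (hasDerivAt_eulerProduct (pow_ne_zero k hq0) (norm_pow_lt_one hq hk)).comp q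
    (hasDerivAt_pow k q)
  refine h.congr_deriv ?_
  obtain ⟨m, rfl⟩ := Nat.exists_eq_succ_of_ne_zero hk
  rw [Nat.succ_eq_add_one, Nat.add_sub_cancel]
  field_simp
  ring

/-- The function `{√3 (q²; q²)(q³; q³)² / ((q; q)² (q⁶; q⁶))}⁴` of `q`. -/
noncomputable def wProd (q : ℂ) : ℂ :=
  (((Real.sqrt 3 : ℝ) : ℂ) * ((eulerProduct (q ^ 2) * eulerProduct (q ^ 3) ^ 2) /
    (eulerProduct q ^ 2 * eulerProduct (q ^ 6)))) ^ 4

theorem sqrt_three_pow_four : ((Real.sqrt 3 : ℝ) : ℂ) ^ 4 = 9 := by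
  rw [← Complex.ofReal_pow, show Real.sqrt 3 ^ 4 = (Real.sqrt 3 ^ 2) ^ 2 by ring,
    Real.sq_sqrt (by norm_num)]
  norm_num

theorem wProd_eq_phi {q : ℂ} (hq : ‖q‖ < 1) : wProd q = 9 * (phi (q ^ 3) / phi q) ^ 4 := by
  have h1 := eulerProduct_ne_zero hq
  have h2 := eulerProduct_ne_zero (norm_pow_lt_one hq two_ne_zero)
  have h6 := eulerProduct_ne_zero (norm_pow_lt_one hq (k := 6) (by norm_num))
  rw [wProd, mul_pow, sqrt_three_pow_four, phi, phi, ← pow_mul]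
  norm_num only
  congr 2
  field_simp

theorem hasDerivAt_wProd {q : ℂ} (hq0 : q ≠ 0) (hq : ‖q‖ < 1) :
    HasDerivAt wProd (8 * wProd q * ((lamId q - 3 * lamId (q ^ 3)) -
      (lamId (q ^ 2) - 3 * lamId (q ^ 6))) / q) q := by
  have h1 := eulerProduct_ne_zero hq
  have h6 := eulerProduct_ne_zero (norm_pow_lt_one hq (k := 6) (by norm_num))
  have d1 := hasDerivAt_eulerProduct hq0 hq
  have d2 := hasDerivAt_eulerProduct_pow hq0 hq two_ne_zero
  have d3 := hasDerivAt_eulerProduct_pow hq0 hq three_ne_zero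
  have d6 := hasDerivAt_eulerProduct_pow hq0 hq (k := 6) (by norm_num)
  have h := (((d2.mul (d3.pow 2)).div ((d1.pow 2).mul d6)
    (mul_ne_zero (pow_ne_zero 2 h1) h6)).const_mul ((Real.sqrt 3 : ℝ) : ℂ)).pow 4
  refine h.congr_deriv ?_
  rw [wProd]
  simp only [Pi.mul_apply, Pi.pow_apply, Pi.div_apply]
  push_cast
  field_simp
  ring

/-- The Riccati equation for the product. -/
theorem riccati_wProd {q : ℂ} (hq0 : q ≠ 0) (hq : ‖q‖ < 1) :
    q * deriv wProd q = (1 / 2 ^ 3 : ℂ) *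
      ((eulerProduct q ^ 2 * eulerProduct (q ^ 3) ^ 2) /
        (eulerProduct (q ^ 2) * eulerProduct (q ^ 6))) ^ 2 *
      (wProd q ^ 2 - 10 * wProd q + 9) := by
  have hq2 := norm_pow_lt_one hq two_ne_zero
  have hq3 := norm_pow_lt_one hq three_ne_zero
  have hx := phi_ne_zero hq
  have hxy : eulerProduct q ^ 2 * eulerProduct (q ^ 3) ^ 2 /
      (eulerProduct (q ^ 2) * eulerProduct (q ^ 6)) = phi q * phi (q ^ 3) := by
    rw [phi, phi, ← pow_mul, div_mul_div_comm]
  have a1 := cubicA_sq hq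
  have a2 := cubicA_sq hq2
  rw [← pow_mul] at a2
  norm_num only at a2
  have p1 := phi_cube_div hq0 hq
  have p2 := three_mul_phi_cube_div hq0 hq
  rw [(hasDerivAt_wProd hq0 hq).deriv, hxy, wProd_eq_phi hq, mul_div_cancel₀ _ hq0]
  have hy := phi_ne_zero hq3
  have e : (lamId q - 3 * lamId (q ^ 3)) - (lamId (q ^ 2) - 3 * lamId (q ^ 6)) =
      (cubicA q ^ 2 - cubicA (q ^ 2) ^ 2) / 12 := by
    rw [a1, a2]; ring
  rw [e]
  generalize phi q = x at *
  generalize phi (q ^ 3) = y at *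
  have b2 : cubicA (q ^ 2) = (x ^ 3 / y + 3 * y ^ 3 / x) / 4 := by
    rw [p1, p2]; field_simp; ring
  have b1 : cubicA q = (3 * y ^ 3 / x - x ^ 3 / y) / 2 := by
    rw [p1, p2]; field_simp; ring
  rw [b1, b2]
  field_simp
  ring

/-- The nome maps the upper half plane onto the punctured unit disc. -/
theorem exists_nomeQ_eq {q : ℂ} (hq0 : q ≠ 0) (hq : ‖q‖ < 1) : ∃ t : ℂ, 0 < t.im ∧ nomeQ t = q := by
  refine ⟨Function.Periodic.invQParam 1 q, ?_, ?_⟩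
  · rw [Function.Periodic.im_invQParam]
    have h1 := Real.log_neg (norm_pos_iff.2 hq0) hq
    have h2 : (0 : ℝ) < 1 / (2 * Real.pi) := by positivity
    rw [neg_div]
    nlinarith
  · simpa [Function.Periodic.qParam, nomeQ] using
      Function.Periodic.qParam_right_inv (h := 1) one_ne_zero hq0

theorem thetaW_eq {τ : ℂ} (hτ : 0 < τ.im) : thetaW τ = wProd (nomeQ τ) := by
  have hq := norm_nomeQ_lt_one hτ
  have h1 := eulerProduct_ne_zero hq
  have h2 := eulerProduct_ne_zero (norm_pow_lt_one hq two_ne_zero)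
  have h3 := eulerProduct_ne_zero (norm_pow_lt_one hq three_ne_zero)
  have h6 := eulerProduct_ne_zero (norm_pow_lt_one hq (k := 6) (by norm_num))
  have he := Complex.exp_ne_zero (Real.pi * Complex.I * τ / 4)
  rw [thetaW, thetaChar_one_third hτ, thetaChar_two_thirds hτ, wProd, ← div_pow]
  congr 1
  field_simp

theorem thetaChar_two_thirds_ne_zero {τ : ℂ} (hτ : 0 < τ.im) : thetaChar 1 (2 / 3) 0 τ ≠ 0 := by
  have hq := norm_nomeQ_lt_one hτ
  have h1 := eulerProduct_ne_zero hq
  have h2 := eulerProduct_ne_zero (norm_pow_lt_one hq two_ne_zero)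
  have h3 := eulerProduct_ne_zero (norm_pow_lt_one hq three_ne_zero)
  have h6 := eulerProduct_ne_zero (norm_pow_lt_one hq (k := 6) (by norm_num))
  rw [thetaChar_two_thirds hτ]
  exact mul_ne_zero (Complex.exp_ne_zero _)
    (div_ne_zero (mul_ne_zero (pow_ne_zero 2 h1) h6) (mul_ne_zero h2 h3))

end ThetaRiccati

theorem mainTheorem2 (τ : ℂ) (hτ : 0 < τ.im) :
    thetaChar 1 (2 / 3) 0 τ ≠ 0 ∧
    eulerProduct (nomeQ τ) ≠ 0 ∧
    eulerProduct (nomeQ τ ^ 2) ≠ 0 ∧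
    eulerProduct (nomeQ τ ^ 6) ≠ 0 ∧
    thetaW τ =
      (((Real.sqrt 3 : ℝ) : ℂ) *
        ((eulerProduct (nomeQ τ ^ 2) * eulerProduct (nomeQ τ ^ 3) ^ 2) /
          (eulerProduct (nomeQ τ) ^ 2 * eulerProduct (nomeQ τ ^ 6)))) ^ 4 ∧
    ∀ w : ℂ → ℂ, (∀ t : ℂ, 0 < t.im → w (nomeQ t) = thetaW t) →
      DifferentiableAt ℂ w (nomeQ τ) ∧
      nomeQ τ * deriv w (nomeQ τ) =
        (1 / 2 ^ 3 : ℂ) *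
          ((eulerProduct (nomeQ τ) ^ 2 * eulerProduct (nomeQ τ ^ 3) ^ 2) /
            (eulerProduct (nomeQ τ ^ 2) * eulerProduct (nomeQ τ ^ 6))) ^ 2 *
          (w (nomeQ τ) ^ 2 - 10 * w (nomeQ τ) + 9) := by
  have hq := ThetaRiccati.norm_nomeQ_lt_one hτ
  have hq0 := ThetaRiccati.nomeQ_ne_zero τ
  refine ⟨ThetaRiccati.thetaChar_two_thirds_ne_zero hτ, ThetaRiccati.eulerProduct_ne_zero hq,
    ThetaRiccati.eulerProduct_ne_zero (ThetaRiccati.norm_pow_lt_one hq two_ne_zero),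
    ThetaRiccati.eulerProduct_ne_zero (ThetaRiccati.norm_pow_lt_one hq (by norm_num)),
    ThetaRiccati.thetaW_eq hτ, fun w hw => ?_⟩
  -- `w` agrees with the product on the punctured disc, an open neighbourhood of `nomeQ τ`
  have hev : w =ᶠ[nhds (nomeQ τ)] ThetaRiccati.wProd := by
    filter_upwards [isOpen_ne.mem_nhds hq0,
      Metric.isOpen_ball.mem_nhds (show nomeQ τ ∈ Metric.ball (0 : ℂ) 1 by simpa using hq)]
      with x hx0 hx1
    obtain ⟨t, ht, rfl⟩ := ThetaRiccati.exists_nomeQ_eq hx0 (by simpa using hx1)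
    rw [hw t ht, ThetaRiccati.thetaW_eq ht]
  refine ⟨hev.differentiableAt_iff.2
    (ThetaRiccati.hasDerivAt_wProd hq0 hq).differentiableAt, ?_⟩
  rw [hev.deriv_eq, hev.eq_of_nhds, ThetaRiccati.riccati_wProd hq0 hq]
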